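/- **Theorem 5.5.** Let $(X,\Sigma)$ be a measurable space and let $p(x,E)$ be a (countably additive) Markov transition function on it: $p(x,\cdot)$ is a countably additive probability measure for every $x\in X$, and $p(\cdot,E)$ is $\Sigma$-measurable for every $E\in\Sigma$. Let $p^k$ denote the $k$-step transition function. Let $ba(X,\Sigma)$ be the space of bounded finitely additive measures $\mu:\Sigma\to\mathbb R$ with the total variation norm and the setwise order, $ca(X,\Sigma)$ its subspace of countably additive measures, and $A:ba(X,\Sigma)\to ba(X,\Sigma)$, $A\mu(E)=\int_X p(x,E)\,\mu(dx)$, the Markov operator, which maps $ca(X,\Sigma)$ into itself. Put $S_{ba}=\{\mu\in ba(X,\Sigma):\mu\ge 0,\ \|\mu\|=1\}$, $\Delta_{ba}=\{\mu\in S_{ba}: A\mu=\mu\}$ and $M_{ba}=\{\mu\in ba(X,\Sigma):A\mu=\mu\}$. Suppose that: * $(**)$ $\dim M_{ba}<\infty$; * $(\alpha)$ for every $\mu\in\Delta_{ba}$ and every $K_\mu\in\Sigma$ with $\mu(K_\mu)=1$ there is $K\in\Sigma$, $K\subset K_\mu$, such that $\mu(K)=1$ and $K$ is stochastically closed, i.e.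 $p(x,K)=1$ for all $x\in K$; * $(\beta)$ the members of the disjoint basis of $M_{ba}$ are pairwise singular. That is, if $\mu_1,\dots,\mu_m\in S_{ba}$ form a linear basis of $M_{ba}$ and $\mu_i\wedge\mu_j=0$ in the lattice $ba(X,\Sigma)$ for all $i\ne j$, then for all $i\neq j$ there are disjoint $D_1,D_2\in\Sigma$ with $\mu_i(D_1)=\mu_i(X)$ and $\mu_j(D_2)=\mu_j(X)$. Then all of the following hold: * $(*)$ $\Delta_{ba}\subset ca(X,\Sigma)$, i.e. every invariant finitely additive probability measure is countably additive; * $(D)$ there are a finite countably additive measure $\varphi\ge0$ on $\Sigma$, a number $\varepsilon>0$ and an integer $k\ge1$ such that for every $E\in\Sigma$ with $\varphi(E)\le\varepsilon$ one has $p^k(x,E)\le 1-\varepsilon$ for all $x\in X$; * $(\tilde D)$ there are a finite countably additive measure $\varphi\ge0$ on $\Sigma$, a number $\varepsilon>0$ and an integer $m\ge1$ such that for every $E\in\Sigma$ with $\varphi(E)<\varepsilon$ one has $\frac1m\sum_{k=1}^m p^k(x,E)\le 1-\varepsilon$ for all $x\in X$; * $(K)$ the chain is quasicompact: there are a compact linear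 operator $A_1:ca(X,\Sigma)\to ca(X,\Sigma)$ and an integer $k\ge1$ with $\|A^k-A_1\|<1$, where $A$ is regarded as an operator on $ca(X,\Sigma)$. -/

import Mathlib

open MeasureTheory ProbabilityTheory Filter Topology

noncomputable section

/-- A bounded finitely additive real-valued set function on the `σ`-algebra of `X`
(an element of `ba(X, Σ)`). Non-measurable sets get the dummy value `0`. -/
structure FinAddMeasure (X : Type*) [MeasurableSpace X] where
  /-- The value on a set. -/
  toFun : Set X → ℝ
  not_measurable' : ∀ E, ¬ MeasurableSet E → toFun E = 0
  empty' : toFun ∅ = 0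
  union' : ∀ E F, MeasurableSet E → MeasurableSet F → Disjoint E F →
    toFun (E ∪ F) = toFun E + toFun F
  bounded' : ∃ C : ℝ, ∀ E, |toFun E| ≤ C

namespace FinAddMeasure

variable {X : Type*} [MeasurableSpace X]

instance : CoeFun (FinAddMeasure X) (fun _ => Set X → ℝ) := ⟨toFun⟩

theorem coe_injective :
    Function.Injective (fun (μ : FinAddMeasure X) (E : Set X) => μ E) := by
  rintro ⟨f, _, _, _, _⟩ ⟨g, _, _, _, _⟩ h
  have : f = g := h
  subst this
  rfl

theorem ext_of_measurable {μ ν : FinAddMeasure X}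
    (h : ∀ E, MeasurableSet E → μ E = ν E) : μ = ν := by
  apply coe_injective
  funext E
  by_cases hE : MeasurableSet E
  · exact h E hE
  · exact (μ.not_measurable' E hE).trans (ν.not_measurable' E hE).symm

instance : Zero (FinAddMeasure X) :=
  ⟨⟨fun _ => 0, fun _ _ => rfl, rfl, fun _ _ _ _ _ => by simp, 0, fun _ => by simp⟩⟩

instance : Add (FinAddMeasure X) :=
  ⟨fun μ ν => ⟨fun E => μ E + ν E,
    fun E hE => by simp [μ.not_measurable' E hE, ν.not_measurable' E hE],
    by simp [μ.empty', ν.empty'],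
    fun E F hE hF h => by rw [μ.union' E F hE hF h, ν.union' E F hE hF h]; ring,
    by
      obtain ⟨C, hC⟩ := μ.bounded'
      obtain ⟨D, hD⟩ := ν.bounded'
      exact ⟨C + D, fun E => (abs_add_le _ _).trans (add_le_add (hC E) (hD E))⟩⟩⟩

instance {S : Type*} [Monoid S] [DistribMulAction S ℝ]
    [IsScalarTower S ℝ ℝ] : SMul S (FinAddMeasure X) :=
  ⟨fun c μ => ⟨fun E => c • μ E,
    fun E hE => by simp [μ.not_measurable' E hE],
    by simp [μ.empty'],
    fun E F hE hF h => by rw [μ.union' E F hE hF h, smul_add],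
    by
      obtain ⟨C, hC⟩ := μ.bounded'
      refine ⟨|c • (1 : ℝ)| * C, fun E => ?_⟩
      have : c • μ E = (c • (1 : ℝ)) * μ E := by rw [smul_mul_assoc, one_mul]
      rw [this, abs_mul]
      exact mul_le_mul_of_nonneg_left (hC E) (abs_nonneg _)⟩⟩

instance : Neg (FinAddMeasure X) := ⟨fun μ => (-1 : ℝ) • μ⟩

instance : Sub (FinAddMeasure X) := ⟨fun μ ν => μ + -ν⟩

@[simp] theorem zero_apply (E : Set X) : (0 : FinAddMeasure X) E = 0 := rfl
@[simp] theorem add_apply (μ ν : FinAddMeasure X) (E : Set X) : (μ + ν) E = μ E + ν E := rfl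
@[simp] theorem smul_apply (c : ℝ) (μ : FinAddMeasure X) (E : Set X) : (c • μ) E = c * μ E := rfl
@[simp] theorem neg_apply (μ : FinAddMeasure X) (E : Set X) : (-μ) E = -μ E := by
  change (-1 : ℝ) * μ E = _
  ring
@[simp] theorem sub_apply (μ ν : FinAddMeasure X) (E : Set X) : (μ - ν) E = μ E - ν E := by
  change μ E + (-ν) E = _
  rw [neg_apply]; ring

instance : AddCommGroup (FinAddMeasure X) :=
  coe_injective.addCommGroup _ rfl (fun _ _ => rfl) (fun μ => by funext E; simp)
    (fun μ ν => by funext E; simp) (fun _ _ => rfl) (fun _ _ => rfl)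

/-- Evaluation as an additive homomorphism into functions. -/
def coeHom : FinAddMeasure X →+ (Set X → ℝ) where
  toFun μ := μ.toFun
  map_zero' := rfl
  map_add' _ _ := rfl

instance : Module ℝ (FinAddMeasure X) :=
  coe_injective.module ℝ coeHom (fun _ _ => rfl)

/-- The natural (setwise) order on `ba(X, Σ)`. -/
instance : PartialOrder (FinAddMeasure X) where
  le μ ν := ∀ E, MeasurableSet E → μ E ≤ ν E
  le_refl _ _ _ := le_rfl
  le_trans _ _ _ h₁ h₂ E hE := (h₁ E hE).trans (h₂ E hE)
  le_antisymm _ _ h₁ h₂ := ext_of_measurable fun E hE => le_antisymm (h₁ E hE) (h₂ E hE)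

theorem le_def {μ ν : FinAddMeasure X} : μ ≤ ν ↔ ∀ E, MeasurableSet E → μ E ≤ ν E := Iff.rfl

theorem sum_apply_biUnion (μ : FinAddMeasure X) {ι : Type*} (s : Finset ι) (P : ι → Set X)
    (hP : ∀ i ∈ s, MeasurableSet (P i)) (hd : (s : Set ι).PairwiseDisjoint P) :
    μ (⋃ i ∈ s, P i) = ∑ i ∈ s, μ (P i) := by
  classical
  induction s using Finset.induction_on with
  | empty => simpa using μ.empty'
  | insert a s ha ih =>
    rw [Finset.set_biUnion_insert, Finset.sum_insert ha, μ.union', ih]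
    · exact fun i hi => hP i (Finset.mem_insert_of_mem hi)
    · exact hd.subset (by simp)
    · exact hP a (Finset.mem_insert_self _ _)
    · exact Finset.measurableSet_biUnion s fun i hi => hP i (Finset.mem_insert_of_mem hi)
    · rw [Set.disjoint_iUnion₂_right]
      intro i hi
      exact hd (by simp) (by simp [hi]) (fun h => ha (h ▸ hi))

/-- The sums `∑ |μ(P i)|` over finite families of pairwise disjoint measurable sets. -/
def variationSums (μ : FinAddMeasure X) : Set ℝ :=
  {s | ∃ (n : ℕ) (P : Fin n → Set X), (∀ i, MeasurableSet (P i)) ∧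
    Pairwise (Function.onFun Disjoint P) ∧ s = ∑ i, |μ (P i)|}

theorem sum_abs_le_of_bound (μ : FinAddMeasure X) {C : ℝ} (hC : ∀ E, |μ E| ≤ C)
    {ι : Type*} (s : Finset ι) (P : ι → Set X)
    (hP : ∀ i ∈ s, MeasurableSet (P i)) (hd : (s : Set ι).PairwiseDisjoint P) :
    ∑ i ∈ s, |μ (P i)| ≤ 2 * C := by
  classical
  rw [← Finset.sum_filter_add_sum_filter_not s (fun i => 0 ≤ μ (P i))]
  have h1 : ∑ i ∈ s with 0 ≤ μ (P i), |μ (P i)| ≤ C := by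
    rw [Finset.sum_congr rfl (g := fun i => μ (P i))
      (fun i hi => abs_of_nonneg (Finset.mem_filter.1 hi).2), ← sum_apply_biUnion]
    · exact (le_abs_self _).trans (hC _)
    · exact fun i hi => hP i (Finset.mem_filter.1 hi).1
    · exact hd.subset (by intro i hi; exact (Finset.mem_filter.1 hi).1)
  have h2 : ∑ i ∈ s with ¬ 0 ≤ μ (P i), |μ (P i)| ≤ C := by
    rw [Finset.sum_congr rfl (g := fun i => -μ (P i))
      (fun i hi => abs_of_neg (not_le.1 (Finset.mem_filter.1 hi).2)), Finset.sum_neg_distrib,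
      ← sum_apply_biUnion]
    · exact (neg_le_abs _).trans (hC _)
    · exact fun i hi => hP i (Finset.mem_filter.1 hi).1
    · exact hd.subset (by intro i hi; exact (Finset.mem_filter.1 hi).1)
  linarith

theorem bddAbove_variationSums (μ : FinAddMeasure X) : BddAbove μ.variationSums := by
  obtain ⟨C, hC⟩ := μ.bounded'
  refine ⟨2 * C, ?_⟩
  rintro _ ⟨n, P, hP, hd, rfl⟩
  exact sum_abs_le_of_bound μ hC Finset.univ P (fun i _ => hP i) (fun i _ j _ h => hd h)

theorem zero_mem_variationSums (μ : FinAddMeasure X) : (0 : ℝ) ∈ μ.variationSums :=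
  ⟨0, fun _ => ∅, fun _ => MeasurableSet.empty, fun i => i.elim0, by simp⟩

/-- The total variation of a finitely additive measure. -/
def totalVariation (μ : FinAddMeasure X) : ℝ := sSup μ.variationSums

theorem sum_abs_le_totalVariation (μ : FinAddMeasure X) {ι : Type*} (s : Finset ι) (P : ι → Set X)
    (hP : ∀ i ∈ s, MeasurableSet (P i)) (hd : (s : Set ι).PairwiseDisjoint P) :
    ∑ i ∈ s, |μ (P i)| ≤ μ.totalVariation := by
  refine le_csSup μ.bddAbove_variationSums
    ⟨s.card, fun i => P (s.equivFin.symm i), fun i => hP _ (s.equivFin.symm i).2, ?_, ?_⟩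
  · intro i j hij
    exact hd (s.equivFin.symm i).2 (s.equivFin.symm j).2
      (fun h => hij (s.equivFin.symm.injective (Subtype.ext h)))
  · rw [Equiv.sum_comp s.equivFin.symm (fun i : s => |μ (P i)|)]
    exact (Finset.sum_coe_sort s (fun i => |μ (P i)|)).symm

theorem totalVariation_le_of_sums (μ : FinAddMeasure X) {C : ℝ}
    (h : ∀ (n : ℕ) (P : Fin n → Set X), (∀ i, MeasurableSet (P i)) →
      Pairwise (Function.onFun Disjoint P) → ∑ i, |μ (P i)| ≤ C) : μ.totalVariation ≤ C := by
  refine csSup_le ⟨0, μ.zero_mem_variationSums⟩ ?_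
  rintro _ ⟨n, P, hP, hd, rfl⟩
  exact h n P hP hd

theorem abs_apply_le_totalVariation (μ : FinAddMeasure X) (E : Set X) (hE : MeasurableSet E) :
    |μ E| ≤ μ.totalVariation := by
  have := sum_abs_le_totalVariation μ {()} (fun _ => E) (by simpa using hE) (by simp)
  simpa using this

theorem totalVariation_nonneg (μ : FinAddMeasure X) : 0 ≤ μ.totalVariation :=
  le_csSup μ.bddAbove_variationSums μ.zero_mem_variationSums

theorem totalVariation_smul_le (c : ℝ) (μ : FinAddMeasure X) : (c • μ).totalVariation ≤ |c| * μ.totalVariation := by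
  refine totalVariation_le_of_sums _ fun n P hP hd => ?_
  simp only [smul_apply, abs_mul, ← Finset.mul_sum]
  exact mul_le_mul_of_nonneg_left
    (sum_abs_le_totalVariation μ Finset.univ P (fun i _ => hP i) (fun i _ j _ h => hd h)) (abs_nonneg c)

/-- The total variation norm as a group norm. -/
def groupNorm : AddGroupNorm (FinAddMeasure X) where
  toFun μ := μ.totalVariation
  map_zero' := le_antisymm
    (totalVariation_le_of_sums _ fun n P hP hd => by simp) (totalVariation_nonneg _)
  add_le' μ ν := by
    refine totalVariation_le_of_sums _ fun n P hP hd => ?_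
    calc ∑ i, |(μ + ν) (P i)| ≤ ∑ i, (|μ (P i)| + |ν (P i)|) :=
          Finset.sum_le_sum fun i _ => abs_add_le _ _
      _ = ∑ i, |μ (P i)| + ∑ i, |ν (P i)| := Finset.sum_add_distrib
      _ ≤ μ.totalVariation + ν.totalVariation := add_le_add
          (sum_abs_le_totalVariation μ Finset.univ P (fun i _ => hP i) (fun i _ j _ h => hd h))
          (sum_abs_le_totalVariation ν Finset.univ P (fun i _ => hP i) (fun i _ j _ h => hd h))
  neg' μ := by
    have : (-μ).variationSums = μ.variationSums := by
      simp [variationSums]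
    change sSup _ = sSup _
    rw [this]
  eq_zero_of_map_eq_zero' μ h := ext_of_measurable fun E hE =>
    abs_nonpos_iff.1 ((abs_apply_le_totalVariation μ E hE).trans h.le)

/-- `ba(X, Σ)` carries the total variation norm. -/
instance : NormedAddCommGroup (FinAddMeasure X) := groupNorm.toNormedAddCommGroup

instance : NormedSpace ℝ (FinAddMeasure X) where
  norm_smul_le c μ := totalVariation_smul_le c μ

theorem norm_def (μ : FinAddMeasure X) : ‖μ‖ = μ.totalVariation := rfl

theorem sum_abs_le_norm (μ : FinAddMeasure X) {ι : Type*} (s : Finset ι) (P : ι → Set X)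
    (hP : ∀ i ∈ s, MeasurableSet (P i)) (hd : (s : Set ι).PairwiseDisjoint P) :
    ∑ i ∈ s, |μ (P i)| ≤ ‖μ‖ := sum_abs_le_totalVariation μ s P hP hd

theorem norm_le_of_sums (μ : FinAddMeasure X) {C : ℝ}
    (h : ∀ (n : ℕ) (P : Fin n → Set X), (∀ i, MeasurableSet (P i)) →
      Pairwise (Function.onFun Disjoint P) → ∑ i, |μ (P i)| ≤ C) : ‖μ‖ ≤ C :=
  totalVariation_le_of_sums μ h

theorem abs_apply_le_norm (μ : FinAddMeasure X) (E : Set X) (hE : MeasurableSet E) :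
    |μ E| ≤ ‖μ‖ := abs_apply_le_totalVariation μ E hE

/-- For a nonnegative measure the norm is the total mass. -/
theorem norm_eq_of_nonneg (μ : FinAddMeasure X) (h : 0 ≤ μ) : ‖μ‖ = μ Set.univ := by
  refine le_antisymm (norm_le_of_sums _ fun n P hP hd => ?_)
    ((le_abs_self _).trans (abs_apply_le_norm μ _ MeasurableSet.univ))
  have hU : MeasurableSet (⋃ i ∈ (Finset.univ : Finset (Fin n)), P i) :=
    Finset.measurableSet_biUnion _ fun i _ => hP i
  rw [Finset.sum_congr rfl (fun i _ => abs_of_nonneg (h (P i) (hP i))),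
    ← sum_apply_biUnion μ Finset.univ P (fun i _ => hP i) (fun i _ j _ h => hd h)]
  have h1 := μ.union' _ _ hU hU.compl disjoint_compl_right
  rw [Set.union_compl_self] at h1
  have h2 : 0 ≤ μ (⋃ i ∈ (Finset.univ : Finset (Fin n)), P i)ᶜ := h _ hU.compl
  linarith

/-! ### Integration of bounded measurable functions -/

/-- The integral of a simple function. -/
def simpleIntegral (μ : FinAddMeasure X) (g : SimpleFunc X ℝ) : ℝ :=
  ∑ y ∈ g.range, y * μ (g ⁻¹' {y})

/-- Uniform convergence of simple functions to `f`. -/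
def uniformApprox (f : X → ℝ) : Filter (SimpleFunc X ℝ) :=
  ⨅ ε ∈ Set.Ioi (0 : ℝ), 𝓟 {g | ∀ x, |g x - f x| ≤ ε}

/-- The integral of a bounded measurable function: the limit of the integrals of simple functions
converging uniformly to it. -/
def integral (μ : FinAddMeasure X) (f : X → ℝ) : ℝ :=
  limUnder (uniformApprox f) μ.simpleIntegral

/-- Bounded measurable functions, i.e. the elements of `B(X, Σ)`. -/
def IsBddMeas (f : X → ℝ) : Prop := Measurable f ∧ ∃ C : ℝ, ∀ x, |f x| ≤ C

theorem simpleIntegral_eq_setTo (μ : FinAddMeasure X) (g : SimpleFunc X ℝ) :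
    μ.simpleIntegral g =
      g.setToSimpleFunc (fun s => μ s • ContinuousLinearMap.id ℝ ℝ) := by
  simp [simpleIntegral, SimpleFunc.setToSimpleFunc, mul_comm]

theorem finMeasAdditive (μ : FinAddMeasure X) :
    FinMeasAdditive (0 : Measure X) (fun s => μ s • ContinuousLinearMap.id ℝ ℝ) := by
  intro s t hs ht _ _ hd
  change μ (s ∪ t) • _ = _
  rw [μ.union' s t hs ht hd, add_smul]

theorem simpleIntegral_add (μ : FinAddMeasure X) (g h : SimpleFunc X ℝ) :
    μ.simpleIntegral (g + h) = μ.simpleIntegral g + μ.simpleIntegral h := by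
  simp only [simpleIntegral_eq_setTo]
  exact SimpleFunc.setToSimpleFunc_add _ μ.finMeasAdditive (integrable_zero_measure)
    (integrable_zero_measure)

theorem simpleIntegral_sub (μ : FinAddMeasure X) (g h : SimpleFunc X ℝ) :
    μ.simpleIntegral (g - h) = μ.simpleIntegral g - μ.simpleIntegral h := by
  simp only [simpleIntegral_eq_setTo]
  exact SimpleFunc.setToSimpleFunc_sub _ μ.finMeasAdditive (integrable_zero_measure)
    (integrable_zero_measure)

theorem simpleIntegral_smul (μ : FinAddMeasure X) (c : ℝ) (g : SimpleFunc X ℝ) :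
    μ.simpleIntegral (c • g) = c * μ.simpleIntegral g := by
  simp only [simpleIntegral_eq_setTo]
  exact SimpleFunc.setToSimpleFunc_smul_real _ μ.finMeasAdditive c (integrable_zero_measure)

theorem add_simpleIntegral (μ ν : FinAddMeasure X) (g : SimpleFunc X ℝ) :
    (μ + ν).simpleIntegral g = μ.simpleIntegral g + ν.simpleIntegral g := by
  simp [simpleIntegral, mul_add, Finset.sum_add_distrib]

theorem smul_simpleIntegral (c : ℝ) (μ : FinAddMeasure X) (g : SimpleFunc X ℝ) :
    (c • μ).simpleIntegral g = c * μ.simpleIntegral g := by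
  simp [simpleIntegral, Finset.mul_sum, mul_left_comm]

theorem abs_simpleIntegral_le (μ : FinAddMeasure X) (g : SimpleFunc X ℝ) {C : ℝ}
    (hg : ∀ x, |g x| ≤ C) : |μ.simpleIntegral g| ≤ C * ‖μ‖ := by
  rcases isEmpty_or_nonempty X with hX | ⟨⟨x₀⟩⟩
  · have hμ : μ = 0 := ext_of_measurable fun E _ => by
      rw [Set.eq_empty_of_isEmpty E, μ.empty']; rfl
    subst hμ
    simp [simpleIntegral]
  have hC : 0 ≤ C := (abs_nonneg _).trans (hg x₀)
  calc |μ.simpleIntegral g| ≤ ∑ y ∈ g.range, |y * μ (g ⁻¹' {y})| :=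
        Finset.abs_sum_le_sum_abs _ _
    _ ≤ ∑ y ∈ g.range, C * |μ (g ⁻¹' {y})| := by
        refine Finset.sum_le_sum fun y hy => ?_
        obtain ⟨x, rfl⟩ := SimpleFunc.mem_range.1 hy
        rw [abs_mul]
        exact mul_le_mul_of_nonneg_right (hg x) (abs_nonneg _)
    _ = C * ∑ y ∈ g.range, |μ (g ⁻¹' {y})| := (Finset.mul_sum _ _ _).symm
    _ ≤ C * ‖μ‖ := by
        refine mul_le_mul_of_nonneg_left (sum_abs_le_norm μ g.range (fun y => g ⁻¹' {y})
          (fun y _ => g.measurableSet_fiber y) ?_) hC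
        intro a _ b _ hab
        exact Disjoint.preimage _ (by simpa using hab)

theorem abs_simpleIntegral_sub_le (μ : FinAddMeasure X) (g h : SimpleFunc X ℝ) {C : ℝ}
    (hg : ∀ x, |g x - h x| ≤ C) : |μ.simpleIntegral g - μ.simpleIntegral h| ≤ C * ‖μ‖ := by
  rw [← simpleIntegral_sub]
  exact abs_simpleIntegral_le μ _ (by simpa using hg)

theorem mem_uniformApprox (f : X → ℝ) {ε : ℝ} (hε : 0 < ε) :
    {g : SimpleFunc X ℝ | ∀ x, |g x - f x| ≤ ε} ∈ uniformApprox f :=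
  mem_iInf_of_mem ε (mem_iInf_of_mem hε (mem_principal_self _))

theorem exists_simple_approx {f : X → ℝ} (hf : IsBddMeas f) {ε : ℝ} (hε : 0 < ε) :
    ∃ g : SimpleFunc X ℝ, ∀ x, |g x - f x| ≤ ε := by
  obtain ⟨hm, C, hC⟩ := hf
  have hmeas : Measurable (fun x => (⌊f x / ε⌋ : ℤ)) := (hm.div_const ε).floor
  have hfin : (Set.range (fun x => (⌊f x / ε⌋ : ℤ))).Finite := by
    refine (Set.finite_Icc ⌊-C / ε⌋ ⌊C / ε⌋).subset ?_
    rintro _ ⟨x, rfl⟩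
    have := abs_le.1 (hC x)
    exact ⟨Int.floor_le_floor (by gcongr; exact this.1), Int.floor_le_floor (by gcongr; exact this.2)⟩
  let k : SimpleFunc X ℤ := ⟨fun x => ⌊f x / ε⌋, fun y => hmeas (measurableSet_singleton y), hfin⟩
  refine ⟨k.map (fun n : ℤ => (n : ℝ) * ε), fun x => ?_⟩
  have h1 : (⌊f x / ε⌋ : ℝ) * ε ≤ f x := (le_div_iff₀ hε).1 (Int.floor_le _)
  have h2 : f x < ((⌊f x / ε⌋ : ℝ) + 1) * ε := (div_lt_iff₀ hε).1 (Int.lt_floor_add_one _)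
  change |(⌊f x / ε⌋ : ℝ) * ε - f x| ≤ ε
  rw [abs_le]
  constructor <;> nlinarith

theorem uniformApprox_neBot {f : X → ℝ} (hf : IsBddMeas f) : (uniformApprox f).NeBot := by
  unfold uniformApprox
  refine (hasBasis_biInf_principal ?_ ⟨1, one_pos⟩).neBot_iff.2 ?_
  · intro a ha b hb
    refine ⟨min a b, Set.mem_Ioi.2 (lt_min (Set.mem_Ioi.1 ha) (Set.mem_Ioi.1 hb)), ?_, ?_⟩
    · exact fun g hg x => (hg x).trans (min_le_left _ _)
    · exact fun g hg x => (hg x).trans (min_le_right _ _)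
  · intro ε hε
    exact exists_simple_approx hf hε

theorem tendsto_simpleIntegral (μ : FinAddMeasure X) {f : X → ℝ} (hf : IsBddMeas f) :
    Tendsto μ.simpleIntegral (uniformApprox f) (𝓝 (μ.integral f)) := by
  have := uniformApprox_neBot hf
  refine tendsto_nhds_limUnder ?_
  have hc : Cauchy (map μ.simpleIntegral (uniformApprox f)) := by
    rw [Metric.cauchy_iff]
    refine ⟨inferInstance, fun ε hε => ?_⟩
    have hpos : 0 < ‖μ‖ + 1 := by have := norm_nonneg μ; linarith
    set δ := ε / (4 * (‖μ‖ + 1)) with hδ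
    have hδ0 : 0 < δ := by positivity
    refine ⟨_, image_mem_map (mem_uniformApprox f hδ0), ?_⟩
    rintro _ ⟨g, hg, rfl⟩ _ ⟨h, hh, rfl⟩
    rw [Real.dist_eq]
    have h1 : |μ.simpleIntegral g - μ.simpleIntegral h| ≤ (2 * δ) * ‖μ‖ := by
      refine abs_simpleIntegral_sub_le μ g h fun x => ?_
      have a := abs_le.1 (hg x)
      have b := abs_le.1 (hh x)
      rw [abs_le]
      constructor <;> linarith [a.1, a.2, b.1, b.2]
    have h2 : δ * (4 * (‖μ‖ + 1)) = ε := by rw [hδ]; field_simp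
    nlinarith [norm_nonneg μ]
  exact CompleteSpace.complete hc

theorem abs_simpleIntegral_sub_integral_le (μ : FinAddMeasure X) {f : X → ℝ} (hf : IsBddMeas f)
    (g : SimpleFunc X ℝ) {ε : ℝ} (hg : ∀ x, |g x - f x| ≤ ε) :
    |μ.simpleIntegral g - μ.integral f| ≤ ε * ‖μ‖ := by
  have := uniformApprox_neBot hf
  have key : ∀ δ > 0, |μ.simpleIntegral g - μ.integral f| ≤ (ε + δ) * ‖μ‖ := by
    intro δ hδ
    have ht : Tendsto (fun h => |μ.simpleIntegral g - μ.simpleIntegral h|) (uniformApprox f)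
        (𝓝 |μ.simpleIntegral g - μ.integral f|) :=
      (tendsto_const_nhds.sub (tendsto_simpleIntegral μ hf)).abs
    refine le_of_tendsto ht ?_
    filter_upwards [mem_uniformApprox f hδ] with h hh
    refine abs_simpleIntegral_sub_le μ g h fun x => ?_
    have a := abs_le.1 (hg x)
    have b := abs_le.1 (hh x)
    rw [abs_le]
    constructor <;> linarith [a.1, a.2, b.1, b.2]
  have hlim : Tendsto (fun δ : ℝ => (ε + δ) * ‖μ‖) (𝓝[>] 0) (𝓝 ((ε + 0) * ‖μ‖)) := by
    refine Tendsto.mono_left ?_ nhdsWithin_le_nhds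
    exact (Continuous.tendsto (by fun_prop) 0)
  rw [add_zero] at hlim
  exact ge_of_tendsto hlim (by filter_upwards [self_mem_nhdsWithin] with δ hδ using key δ hδ)

/-- A number that the integrals of close simple functions approximate is the integral. -/
theorem integral_eq_of_approx (μ : FinAddMeasure X) {f : X → ℝ} (hf : IsBddMeas f) {I C : ℝ}
    (h : ∀ ε > 0, ∃ g : SimpleFunc X ℝ, (∀ x, |g x - f x| ≤ ε) ∧ |μ.simpleIntegral g - I| ≤ ε * C) :
    μ.integral f = I := by
  by_contra hne
  have hpos : 0 < |μ.integral f - I| := abs_pos.2 (sub_ne_zero.2 hne)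
  set d := |μ.integral f - I| with hd
  have hC : 0 < ‖μ‖ + |C| + 1 := by
    have := norm_nonneg μ; have := abs_nonneg C; linarith
  obtain ⟨g, hg, hgI⟩ := h (d / (2 * (‖μ‖ + |C| + 1))) (by positivity)
  set ε := d / (2 * (‖μ‖ + |C| + 1)) with hε
  have hε0 : 0 < ε := by positivity
  have h1 := abs_simpleIntegral_sub_integral_le μ hf g hg
  have h2 : d ≤ ε * ‖μ‖ + ε * C := by
    rw [hd]
    calc |μ.integral f - I| = |(μ.simpleIntegral g - I) - (μ.simpleIntegral g - μ.integral f)| := by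
          congr 1; ring
      _ ≤ |μ.simpleIntegral g - I| + |μ.simpleIntegral g - μ.integral f| := abs_sub _ _
      _ ≤ ε * ‖μ‖ + ε * C := by linarith
  have h3 : ε * (2 * (‖μ‖ + |C| + 1)) = d := by rw [hε]; field_simp
  nlinarith [le_abs_self C, norm_nonneg μ, abs_nonneg C]

theorem IsBddMeas.add {f g : X → ℝ} (hf : IsBddMeas f) (hg : IsBddMeas g) :
    IsBddMeas (fun x => f x + g x) := by
  obtain ⟨hf, C, hC⟩ := hf
  obtain ⟨hg, D, hD⟩ := hg
  exact ⟨hf.add hg, C + D, fun x => (abs_add_le _ _).trans (add_le_add (hC x) (hD x))⟩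

theorem IsBddMeas.const_mul {f : X → ℝ} (hf : IsBddMeas f) (c : ℝ) :
    IsBddMeas (fun x => c * f x) := by
  obtain ⟨hf, C, hC⟩ := hf
  exact ⟨hf.const_mul c, |c| * C, fun x => by
    rw [abs_mul]; exact mul_le_mul_of_nonneg_left (hC x) (abs_nonneg _)⟩

theorem isBddMeas_const (c : ℝ) : IsBddMeas (fun _ : X => c) :=
  ⟨measurable_const, |c|, fun _ => le_rfl⟩

theorem IsBddMeas.sum {ι : Type*} (s : Finset ι) {f : ι → X → ℝ} (hf : ∀ i ∈ s, IsBddMeas (f i)) :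
    IsBddMeas (fun x => ∑ i ∈ s, f i x) := by
  classical
  induction s using Finset.induction_on with
  | empty => simpa using isBddMeas_const (X := X) 0
  | insert a s ha ih =>
    simp only [Finset.sum_insert ha]
    exact (hf a (by simp)).add (ih fun i hi => hf i (Finset.mem_insert_of_mem hi))

theorem integral_add (μ : FinAddMeasure X) {f g : X → ℝ} (hf : IsBddMeas f) (hg : IsBddMeas g) :
    μ.integral (fun x => f x + g x) = μ.integral f + μ.integral g := by
  refine integral_eq_of_approx μ (hf.add hg) (C := ‖μ‖) fun ε hε => ?_
  obtain ⟨u, hu⟩ := exists_simple_approx hf (half_pos hε)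
  obtain ⟨v, hv⟩ := exists_simple_approx hg (half_pos hε)
  refine ⟨u + v, fun x => ?_, ?_⟩
  · have a := abs_le.1 (hu x)
    have b := abs_le.1 (hv x)
    rw [SimpleFunc.coe_add, Pi.add_apply, abs_le]
    constructor <;> linarith [a.1, a.2, b.1, b.2]
  · have a := abs_le.1 (abs_simpleIntegral_sub_integral_le μ hf u hu)
    have b := abs_le.1 (abs_simpleIntegral_sub_integral_le μ hg v hv)
    rw [simpleIntegral_add, abs_le]
    constructor <;> nlinarith [a.1, a.2, b.1, b.2]

theorem integral_const_mul (μ : FinAddMeasure X) (c : ℝ) {f : X → ℝ} (hf : IsBddMeas f) :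
    μ.integral (fun x => c * f x) = c * μ.integral f := by
  refine integral_eq_of_approx μ (hf.const_mul c) (C := ‖μ‖) fun ε hε => ?_
  have hc : 0 < |c| + 1 := by positivity
  obtain ⟨u, hu⟩ := exists_simple_approx hf (div_pos hε hc)
  have hle : |c| * (ε / (|c| + 1)) ≤ ε := by
    rw [mul_div_assoc', div_le_iff₀ hc]; nlinarith [abs_nonneg c]
  refine ⟨c • u, fun x => ?_, ?_⟩
  · change |c * u x - c * f x| ≤ ε
    rw [← mul_sub, abs_mul]
    exact (mul_le_mul_of_nonneg_left (hu x) (abs_nonneg c)).trans hle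
  · have a := abs_simpleIntegral_sub_integral_le μ hf u hu
    rw [simpleIntegral_smul, ← mul_sub, abs_mul]
    calc |c| * |μ.simpleIntegral u - μ.integral f| ≤ |c| * (ε / (|c| + 1) * ‖μ‖) :=
          mul_le_mul_of_nonneg_left a (abs_nonneg c)
      _ = |c| * (ε / (|c| + 1)) * ‖μ‖ := by ring
      _ ≤ ε * ‖μ‖ := mul_le_mul_of_nonneg_right hle (norm_nonneg μ)

theorem integral_zero (μ : FinAddMeasure X) : μ.integral (fun _ => 0) = 0 := by
  have := integral_const_mul μ 0 (isBddMeas_const (X := X) 0)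
  simpa using this

theorem integral_sum (μ : FinAddMeasure X) {ι : Type*} (s : Finset ι) {f : ι → X → ℝ}
    (hf : ∀ i ∈ s, IsBddMeas (f i)) :
    μ.integral (fun x => ∑ i ∈ s, f i x) = ∑ i ∈ s, μ.integral (f i) := by
  classical
  induction s using Finset.induction_on with
  | empty => simpa using integral_zero μ
  | insert a s ha ih =>
    have hs : ∀ i ∈ s, IsBddMeas (f i) := fun i hi => hf i (Finset.mem_insert_of_mem hi)
    simp only [Finset.sum_insert ha]
    rw [integral_add μ (hf a (by simp)) (IsBddMeas.sum s hs), ih hs]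

theorem add_integral (μ ν : FinAddMeasure X) {f : X → ℝ} (hf : IsBddMeas f) :
    (μ + ν).integral f = μ.integral f + ν.integral f := by
  refine integral_eq_of_approx _ hf (C := ‖μ‖ + ‖ν‖) fun ε hε => ?_
  obtain ⟨u, hu⟩ := exists_simple_approx hf hε
  refine ⟨u, hu, ?_⟩
  have a := abs_le.1 (abs_simpleIntegral_sub_integral_le μ hf u hu)
  have b := abs_le.1 (abs_simpleIntegral_sub_integral_le ν hf u hu)
  rw [add_simpleIntegral, abs_le]
  constructor <;> nlinarith [a.1, a.2, b.1, b.2]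

theorem smul_integral (c : ℝ) (μ : FinAddMeasure X) {f : X → ℝ} (hf : IsBddMeas f) :
    (c • μ).integral f = c * μ.integral f := by
  refine integral_eq_of_approx _ hf (C := |c| * ‖μ‖) fun ε hε => ?_
  obtain ⟨u, hu⟩ := exists_simple_approx hf hε
  refine ⟨u, hu, ?_⟩
  have a := abs_simpleIntegral_sub_integral_le μ hf u hu
  rw [smul_simpleIntegral, ← mul_sub, abs_mul]
  calc |c| * |μ.simpleIntegral u - μ.integral f| ≤ |c| * (ε * ‖μ‖) :=
        mul_le_mul_of_nonneg_left a (abs_nonneg c)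
    _ = ε * (|c| * ‖μ‖) := by ring

theorem abs_integral_le (μ : FinAddMeasure X) {f : X → ℝ} (hf : IsBddMeas f) {C : ℝ}
    (hC : ∀ x, |f x| ≤ C) : |μ.integral f| ≤ C * ‖μ‖ := by
  have key : ∀ ε > 0, |μ.integral f| ≤ (C + 2 * ε) * ‖μ‖ := by
    intro ε hε
    obtain ⟨u, hu⟩ := exists_simple_approx hf hε
    have h1 := abs_le.1 (abs_simpleIntegral_sub_integral_le μ hf u hu)
    have h2 : |μ.simpleIntegral u| ≤ (C + ε) * ‖μ‖ := abs_simpleIntegral_le μ u fun x => by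
      have a := abs_le.1 (hu x)
      have b := abs_le.1 (hC x)
      rw [abs_le]
      constructor <;> linarith [a.1, a.2, b.1, b.2]
    have h2 := abs_le.1 h2
    rw [abs_le]
    constructor <;> nlinarith [h1.1, h1.2, h2.1, h2.2]
  have hlim : Tendsto (fun δ : ℝ => (C + 2 * δ) * ‖μ‖) (𝓝[>] 0) (𝓝 ((C + 2 * 0) * ‖μ‖)) := by
    refine Tendsto.mono_left ?_ nhdsWithin_le_nhds
    exact (Continuous.tendsto (by fun_prop) 0)
  rw [mul_zero, add_zero] at hlim
  exact ge_of_tendsto hlim (by filter_upwards [self_mem_nhdsWithin] with δ hδ using key δ hδ)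

end FinAddMeasure

open FinAddMeasure

section Markov

variable {X : Type*} [MeasurableSpace X]

/-! ### The Markov operator -/

theorem isBddMeas_kernel (κ : Kernel X X) [IsMarkovKernel κ] {E : Set X} (hE : MeasurableSet E) :
    IsBddMeas (fun x => (κ x).real E) :=
  ⟨(κ.measurable_coe hE).ennreal_toReal, 1, fun x => by
    rw [abs_of_nonneg measureReal_nonneg]; exact measureReal_le_one⟩

theorem sum_abs_integral_kernel_le (κ : Kernel X X) [IsMarkovKernel κ] (μ : FinAddMeasure X)
    {n : ℕ} (P : Fin n → Set X) (hP : ∀ i, MeasurableSet (P i))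
    (hd : Pairwise (Function.onFun Disjoint P)) :
    ∑ i, |μ.integral (fun x => (κ x).real (P i))| ≤ ‖μ‖ := by
  have hs : ∀ i : Fin n, ∃ c : ℝ, |c| ≤ 1 ∧ |μ.integral (fun x => (κ x).real (P i))|
      = c * μ.integral (fun x => (κ x).real (P i)) := by
    intro i
    rcases abs_choice (μ.integral (fun x => (κ x).real (P i))) with h | h
    · exact ⟨1, by simp, by rw [h, one_mul]⟩
    · exact ⟨-1, by simp, by rw [h, neg_one_mul]⟩
  choose c hc hce using hs
  have hb : ∀ i ∈ Finset.univ, IsBddMeas (fun x => c i * (κ x).real (P i)) :=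
    fun i _ => (isBddMeas_kernel κ (hP i)).const_mul (c i)
  have h1 : ∑ i, |μ.integral (fun x => (κ x).real (P i))| =
      μ.integral (fun x => ∑ i, c i * (κ x).real (P i)) := by
    rw [integral_sum μ Finset.univ hb]
    exact Finset.sum_congr rfl fun i _ => by
      rw [hce i, integral_const_mul μ (c i) (isBddMeas_kernel κ (hP i))]
  rw [h1]
  refine (le_abs_self _).trans ?_
  rw [← one_mul ‖μ‖]
  refine abs_integral_le μ (IsBddMeas.sum _ hb) fun x => ?_
  calc |∑ i, c i * (κ x).real (P i)| ≤ ∑ i, |c i * (κ x).real (P i)| :=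
        Finset.abs_sum_le_sum_abs _ _
    _ ≤ ∑ i, (κ x).real (P i) := Finset.sum_le_sum fun i _ => by
        rw [abs_mul, abs_of_nonneg (measureReal_nonneg (μ := κ x) (s := P i))]
        exact mul_le_of_le_one_left measureReal_nonneg (hc i)
    _ = (κ x).real (⋃ i ∈ (Finset.univ : Finset (Fin n)), P i) :=
        (measureReal_biUnion_finset (fun i _ j _ h => hd h) (fun i _ => hP i)).symm
    _ ≤ 1 := measureReal_le_one

open Classical in
/-- The finitely additive measure `Aμ`, `(Aμ)(E) = ∫ p(x, E) μ(dx)`. -/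
def markovImage (κ : Kernel X X) [IsMarkovKernel κ] (μ : FinAddMeasure X) : FinAddMeasure X where
  toFun E := if MeasurableSet E then μ.integral (fun x => (κ x).real E) else 0
  not_measurable' E hE := if_neg hE
  empty' := by simp [integral_zero μ]
  union' E F hE hF h := by
    rw [if_pos (hE.union hF), if_pos hE, if_pos hF,
      ← integral_add μ (isBddMeas_kernel κ hE) (isBddMeas_kernel κ hF)]
    congr 1
    funext x
    exact measureReal_union h hF
  bounded' := by
    refine ⟨1 * ‖μ‖, fun E => ?_⟩
    split_ifs with hE
    · exact abs_integral_le μ (isBddMeas_kernel κ hE) fun x => by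
        rw [abs_of_nonneg measureReal_nonneg]; exact measureReal_le_one
    · simp

theorem markovImage_apply (κ : Kernel X X) [IsMarkovKernel κ] (μ : FinAddMeasure X) {E : Set X}
    (hE : MeasurableSet E) : markovImage κ μ E = μ.integral (fun x => (κ x).real E) := if_pos hE

/-- The Markov operator `A : ba(X, Σ) → ba(X, Σ)`, `(Aμ)(E) = ∫ p(x, E) μ(dx)`. -/
def markovOp (κ : Kernel X X) [IsMarkovKernel κ] : FinAddMeasure X →L[ℝ] FinAddMeasure X :=
  LinearMap.mkContinuous
    { toFun := markovImage κ
      map_add' := fun μ ν => ext_of_measurable fun E hE => by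
        rw [FinAddMeasure.add_apply, markovImage_apply κ _ hE, markovImage_apply κ _ hE,
          markovImage_apply κ _ hE, add_integral μ ν (isBddMeas_kernel κ hE)]
      map_smul' := fun c μ => ext_of_measurable fun E hE => by
        rw [RingHom.id_apply, FinAddMeasure.smul_apply, markovImage_apply κ _ hE,
          markovImage_apply κ _ hE, smul_integral c μ (isBddMeas_kernel κ hE)] }
    1 fun μ => by
      rw [one_mul]
      refine norm_le_of_sums _ fun n P hP hd => ?_
      refine le_trans (le_of_eq ?_) (sum_abs_integral_kernel_le κ μ P hP hd)
      exact Finset.sum_congr rfl fun i _ => congrArg abs (markovImage_apply κ μ (hP i))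

theorem markovOp_apply (κ : Kernel X X) [IsMarkovKernel κ] (μ : FinAddMeasure X) {E : Set X}
    (hE : MeasurableSet E) : markovOp κ μ E = μ.integral (fun x => (κ x).real E) :=
  markovImage_apply κ μ hE

/-! ### Countably additive measures -/

/-- Countable additivity. -/
def FinAddMeasure.IsCountablyAdditive (μ : FinAddMeasure X) : Prop :=
  ∀ E : ℕ → Set X, (∀ i, MeasurableSet (E i)) → Pairwise (Function.onFun Disjoint E) →
    HasSum (fun i => μ (E i)) (μ (⋃ i, E i))

variable (X) in
/-- The subspace `ca(X, Σ)` of countably additive measures. -/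
def caSubspace : Submodule ℝ (FinAddMeasure X) where
  carrier := {μ | μ.IsCountablyAdditive}
  zero_mem' := fun E _ _ => by simp
  add_mem' := fun hμ hν E hE hd => (hμ E hE hd).add (hν E hE hd)
  smul_mem' := fun c _ hμ E hE hd => (hμ E hE hd).mul_left c

theorem mem_caSubspace {μ : FinAddMeasure X} : μ ∈ caSubspace X ↔ μ.IsCountablyAdditive := Iff.rfl

/-- The signed measure given by a countably additive element of `ba(X, Σ)`. -/
def FinAddMeasure.toSignedMeasure (μ : FinAddMeasure X) (h : μ.IsCountablyAdditive) :
    SignedMeasure X where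
  measureOf' := μ.toFun
  empty' := μ.empty'
  not_measurable' := μ.not_measurable'
  m_iUnion' := fun E hE hd => h E hE hd

/-- On countably additive measures the integral is the usual one. -/
theorem integral_eq_of_isCountablyAdditive (μ : FinAddMeasure X) (h : μ.IsCountablyAdditive)
    {f : X → ℝ} (hf : IsBddMeas f) :
    μ.integral f =
      ∫ x, f x ∂(μ.toSignedMeasure h).toJordanDecomposition.posPart -
      ∫ x, f x ∂(μ.toSignedMeasure h).toJordanDecomposition.negPart := by
  set p := (μ.toSignedMeasure h).toJordanDecomposition.posPart
  set q := (μ.toSignedMeasure h).toJordanDecomposition.negPart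
  have hμ : ∀ E, MeasurableSet E → μ E = p.real E - q.real E := fun E hE =>
    (μ.toSignedMeasure h).apply_eq_posPart_real_sub_negPart_real hE
  have hsi : ∀ g : SimpleFunc X ℝ, μ.simpleIntegral g = ∫ x, g x ∂p - ∫ x, g x ∂q := by
    intro g
    rw [g.integral_eq_sum g.integrable_of_isFiniteMeasure,
      g.integral_eq_sum g.integrable_of_isFiniteMeasure, ← Finset.sum_sub_distrib]
    refine Finset.sum_congr rfl fun y _ => ?_
    rw [hμ _ (g.measurableSet_fiber y), smul_eq_mul, smul_eq_mul]
    ring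
  refine integral_eq_of_approx μ hf (C := p.real Set.univ + q.real Set.univ) fun ε hε => ?_
  obtain ⟨u, hu⟩ := exists_simple_approx hf hε
  have hb : ∀ (m : Measure X) [IsFiniteMeasure m],
      |∫ x, u x ∂m - ∫ x, f x ∂m| ≤ ε * m.real Set.univ := by
    intro m _
    obtain ⟨hfm, C, hC⟩ := hf
    have hfi : Integrable f m := Integrable.of_bound hfm.aestronglyMeasurable C
      (ae_of_all _ fun x => by simpa using hC x)
    rw [← MeasureTheory.integral_sub u.integrable_of_isFiniteMeasure hfi, ← Real.norm_eq_abs]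
    exact norm_integral_le_of_norm_le_const (ae_of_all _ fun x => by simpa using hu x)
  refine ⟨u, hu, ?_⟩
  have a := abs_le.1 (hb p)
  have b := abs_le.1 (hb q)
  rw [hsi, abs_le]
  constructor <;> nlinarith [a.1, a.2, b.1, b.2]

theorem integral_kernel_real (κ : Kernel X X) [IsMarkovKernel κ] (m : Measure X) {E : Set X}
    (hE : MeasurableSet E) : ∫ x, (κ x).real E ∂m = (m.bind κ).real E := by
  rw [measureReal_def, Measure.bind_apply hE κ.aemeasurable]
  exact integral_toReal (κ.measurable_coe hE).aemeasurable (ae_of_all _ fun x => measure_lt_top _ _)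

/-- The Markov operator maps `ca(X, Σ)` into itself. -/
theorem markovOp_mem_caSubspace (κ : Kernel X X) [IsMarkovKernel κ] (μ : FinAddMeasure X)
    (hμ : μ ∈ caSubspace X) : markovOp κ μ ∈ caSubspace X := by
  have hμ' : μ.IsCountablyAdditive := hμ
  set p := (μ.toSignedMeasure hμ').toJordanDecomposition.posPart
  set q := (μ.toSignedMeasure hμ').toJordanDecomposition.negPart
  have hfin : ∀ (m : Measure X) [IsFiniteMeasure m], IsFiniteMeasure (m.bind κ) := fun m _ =>
    ⟨by rw [Measure.bind_apply MeasurableSet.univ κ.aemeasurable]; simp⟩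
  have := hfin p
  have := hfin q
  have key : ∀ E, MeasurableSet E → markovOp κ μ E =
      ((p.bind κ).toSignedMeasure - (q.bind κ).toSignedMeasure) E := by
    intro E hE
    rw [markovOp_apply κ μ hE, integral_eq_of_isCountablyAdditive μ hμ' (isBddMeas_kernel κ hE),
      integral_kernel_real κ _ hE, integral_kernel_real κ _ hE, _root_.sub_apply,
      Measure.toSignedMeasure_apply_measurable hE, Measure.toSignedMeasure_apply_measurable hE]
  intro E hE hd
  rw [key _ (MeasurableSet.iUnion hE), funext fun i => key _ (hE i)]
  exact VectorMeasure.m_iUnion _ hE hd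

/-- The Markov operator `A : ca(X, Σ) → ca(X, Σ)`. -/
def markovOpCA (κ : Kernel X X) [IsMarkovKernel κ] : caSubspace X →L[ℝ] caSubspace X :=
  (markovOp κ).restrict (markovOp_mem_caSubspace κ)

/-! ### Invariant measures and the conditions on the chain -/

variable (X) in
/-- Finitely additive probability measures, `S_ba`. -/
def probBA : Set (FinAddMeasure X) := {μ | 0 ≤ μ ∧ ‖μ‖ = 1}

/-- Invariant finitely additive probability measures, `Δ_ba`. -/
def invariantProb (κ : Kernel X X) [IsMarkovKernel κ] : Set (FinAddMeasure X) :=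
  {μ | μ ∈ probBA X ∧ markovOp κ μ = μ}

/-- The linear space `M_ba` of invariant finitely additive measures. -/
def invariantSpace (κ : Kernel X X) [IsMarkovKernel κ] : Submodule ℝ (FinAddMeasure X) where
  carrier := {μ | markovOp κ μ = μ}
  zero_mem' := map_zero _
  add_mem' := fun {μ ν} hμ hν => by
    change markovOp κ (μ + ν) = μ + ν
    rw [map_add, show markovOp κ μ = μ from hμ, show markovOp κ ν = ν from hν]
  smul_mem' := fun c μ hμ => by
    change markovOp κ (c • μ) = c • μ
    rw [map_smul, show markovOp κ μ = μ from hμ]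

/-- Condition (**): the invariant finitely additive measures form a finite-dimensional space. -/
def ConditionDoubleStar (κ : Kernel X X) [IsMarkovKernel κ] : Prop :=
  FiniteDimensional ℝ (invariantSpace κ)

/-- `K` is stochastically closed: a measurable set with `p(x, K) = 1` for all `x ∈ K`. -/
def IsStochasticallyClosed (κ : Kernel X X) (K : Set X) : Prop :=
  MeasurableSet K ∧ ∀ x ∈ K, κ x K = 1

/-- Condition (α). -/
def ConditionAlpha (κ : Kernel X X) [IsMarkovKernel κ] : Prop :=
  ∀ μ ∈ invariantProb κ, ∀ L : Set X, MeasurableSet L → μ L = 1 →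
    ∃ K ⊆ L, μ K = 1 ∧ IsStochasticallyClosed κ K

/-- Two measures are disjoint if their infimum in the ordered space `ba(X, Σ)` is `0`. -/
def FinAddMeasure.IsDisjoint (μ ν : FinAddMeasure X) : Prop :=
  IsGLB {μ, ν} 0

/-- Two nonnegative measures are singular if they have full mass on disjoint measurable sets. -/
def FinAddMeasure.IsSingular (μ ν : FinAddMeasure X) : Prop :=
  ∃ D₁ D₂ : Set X, MeasurableSet D₁ ∧ MeasurableSet D₂ ∧ Disjoint D₁ D₂ ∧
    μ D₁ = μ Set.univ ∧ ν D₂ = ν Set.univ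

/-- A disjoint basis: a basis of `M_ba` made of pairwise disjoint probability measures. -/
structure IsDisjointBasis (κ : Kernel X X) [IsMarkovKernel κ] {m : ℕ}
    (H : Fin m → FinAddMeasure X) : Prop where
  prob : ∀ i, H i ∈ probBA X
  linearIndependent : LinearIndependent ℝ H
  span_eq : Submodule.span ℝ (Set.range H) = invariantSpace κ
  disjoint : ∀ i j, i ≠ j → (H i).IsDisjoint (H j)

/-- Condition (β): the members of the disjoint basis of `M_ba` (which is unique up to order) are
pairwise singular. -/
def ConditionBeta (κ : Kernel X X) [IsMarkovKernel κ] : Prop :=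
  ∀ (m : ℕ) (H : Fin m → FinAddMeasure X), IsDisjointBasis κ H →
    ∀ i j, i ≠ j → (H i).IsSingular (H j)

/-- Condition (*): every invariant finitely additive probability measure is countably additive. -/
def ConditionStar (κ : Kernel X X) [IsMarkovKernel κ] : Prop :=
  ∀ μ ∈ invariantProb κ, μ ∈ caSubspace X

/-- The Doeblin condition (D). Here `κ ^ k` is the `k`-step transition function. -/
def ConditionD (κ : Kernel X X) : Prop :=
  ∃ (φ : Measure X) (ε : ℝ) (k : ℕ), IsFiniteMeasure φ ∧ 0 < ε ∧ 1 ≤ k ∧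
    ∀ E, MeasurableSet E → φ.real E ≤ ε → ∀ x, ((κ ^ k) x).real E ≤ 1 - ε

/-- The averaged Doeblin condition, with `q_m(x, E) = (1/m) ∑_{k=1}^m p^k(x, E)`. -/
def ConditionDTilde (κ : Kernel X X) : Prop :=
  ∃ (φ : Measure X) (ε : ℝ) (m : ℕ), IsFiniteMeasure φ ∧ 0 < ε ∧ 1 ≤ m ∧
    ∀ E, MeasurableSet E → φ.real E < ε →
      ∀ x, (1 / (m : ℝ)) * ∑ k ∈ Finset.Icc 1 m, ((κ ^ k) x).real E ≤ 1 - ε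

/-- Quasicompactness (K) of the Markov operator on `ca(X, Σ)`. -/
def ConditionK (κ : Kernel X X) [IsMarkovKernel κ] : Prop :=
  ∃ (A₁ : caSubspace X →L[ℝ] caSubspace X) (k : ℕ), IsCompactOperator A₁ ∧ 1 ≤ k ∧
    ‖(markovOpCA κ) ^ k - A₁‖ < 1

end Markov

end

noncomputable section

/-! ### Disjoint bases of finite-dimensional Riesz subspaces -/

section RieszSpace

variable {V : Type*} [AddCommGroup V] [Lattice V] [IsOrderedAddMonoid V]

/-! Everything is reduced to one finite countably additive measure `φ` that is invariant and
dominates every invariant finitely additive probability.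

To get `φ`: the operator is positive and preserves total mass, so `M_ba` is closed under positive
parts (`posPart_mem_invariantSpace`). A finite-dimensional Riesz subspace on which total mass is
strictly positive is spanned by disjoint positive elements (`exists_isDisjointFamily_span_eq`);
normalised, they form a disjoint basis `H i`. By (β) there are sets `D i` with `H j (D i) = δ_ij`,
so an invariant `ν` equals `∑ ν(D j) • H j`. By (α) some stochastically closed `K ⊆ D i` carries `H
i`. A chain started in `K` stays there, so every ultrafilter limit of its Cesàro means is an
invariant probability carried by `D i`, hence is `H i`. Thus the means converge setwise to `H i`,
and Nikodym's theorem makes `H i` countably additive. This gives (*), and `φ = ∑ H i` is the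
required measure.

For the Doeblin conditions: if small `φ`-measure did not force uniformly small Cesàro means, sets of
summable `φ`-measure and suitable starting points would produce an invariant limit giving their
union more mass than `φ` does (`exists_cesaroMean_le`). Markov's inequality and the invariance of
`φ` turn the bound on averages into a bound on a single power (`exists_pow_le`).

For quasicompactness: up to a singular part of small mass, `φ ⊗ p^k` has an integrable density with
respect to `φ × φ`, which is approximated in `L¹` by functions that are steps in the first variable.
Hence one finite partition makes `y ↦ p^k(y, E)` nearly constant on atoms in `φ`-mean, uniformly in
`E` (`exists_step_approx`). Applying `p^n`, which gives uniformly little mass to `φ`-small sets,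
turns closeness in mean into closeness uniform in `x` and `E`. So `A^(n+k)` is near a finite-rank
operator. -/

theorem inf_add_eq_zero {a x y : V} (ha : 0 ≤ a) (hx : 0 ≤ x) (hy : 0 ≤ y) (h₁ : a ⊓ x = 0)
    (h₂ : a ⊓ y = 0) : a ⊓ (x + y) = 0 := by
  refine le_antisymm ?_ (le_inf ha (add_nonneg hx hy))
  set z := a ⊓ (x + y)
  -- Peel off the summands: `z - y` lies below both `a` and `x`, so `z ≤ y`, and then `z ≤ a ⊓ y =
  -- 0`.
  have h3 : z - y ≤ a ⊓ x := le_inf ((sub_le_self z hy).trans inf_le_left)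
    (sub_le_iff_le_add.2 inf_le_right)
  rw [h₁] at h3
  rw [← h₂]
  exact le_inf inf_le_left (sub_nonpos.1 h3)

/-- A finite set of nonzero positive elements that are pairwise disjoint. -/
structure IsDisjointFamily {V : Type*} [AddCommGroup V] [Lattice V] (s : Finset V) : Prop where
  nonneg : ∀ a ∈ s, 0 ≤ a
  ne_zero : ∀ a ∈ s, a ≠ 0
  inf_eq_zero : ∀ a ∈ s, ∀ b ∈ s, a ≠ b → a ⊓ b = 0

theorem IsDisjointFamily.insert {V : Type*} [AddCommGroup V] [Lattice V] [DecidableEq V]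
    {s : Finset V} (h : IsDisjointFamily s) {p : V} (hp : 0 ≤ p) (hp0 : p ≠ 0)
    (hps : ∀ a ∈ s, p ⊓ a = 0) :
    p ∉ s ∧ IsDisjointFamily (insert p s) := by
  refine ⟨fun hmem => hp0 (by simpa using hps p hmem), ?_, ?_, ?_⟩
  · intro a ha
    rcases Finset.mem_insert.1 ha with rfl | ha
    exacts [hp, h.nonneg a ha]
  · intro a ha
    rcases Finset.mem_insert.1 ha with rfl | ha
    exacts [hp0, h.ne_zero a ha]
  · intro a ha b hb hab
    rcases Finset.mem_insert.1 ha with ha' | ha' <;> rcases Finset.mem_insert.1 hb with hb' | hb'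
    · exact absurd (ha'.trans hb'.symm) hab
    · rw [ha']; exact hps b hb'
    · rw [hb', inf_comm]; exact hps a ha'
    · exact h.inf_eq_zero a ha' b hb' hab

/-- For disjoint elements the sum is the supremum, because `a + b = a ⊓ b + a ⊔ b`; a common upper
bound therefore bounds the sum. -/
theorem sum_le_of_pairwise_inf_eq_zero {ι : Type*} (s : Finset ι) {u : ι → V} {v : V} (hv : 0 ≤ v)
    (h0 : ∀ i ∈ s, 0 ≤ u i) (hle : ∀ i ∈ s, u i ≤ v)
    (hd : ∀ i ∈ s, ∀ j ∈ s, i ≠ j → u i ⊓ u j = 0) : ∑ i ∈ s, u i ≤ v := by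
  classical
  induction s using Finset.induction_on with
  | empty => simpa using hv
  | insert j s hj ih =>
    have hs : ∑ i ∈ s, u i ≤ v := ih (fun i hi => h0 i (by simp [hi]))
      (fun i hi => hle i (by simp [hi])) (fun i hi k hk => hd i (by simp [hi]) k (by simp [hk]))
    have hinf : ∀ t ⊆ s, u j ⊓ ∑ i ∈ t, u i = 0 := by
      intro t
      induction t using Finset.induction_on with
      | empty => intro _; simpa using h0 j (by simp)
      | insert k t hk iht =>
        intro hts
        have hks : k ∈ s := hts (by simp)
        rw [Finset.sum_insert hk]
        exact inf_add_eq_zero (h0 j (by simp)) (h0 k (by simp [hks]))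
          (Finset.sum_nonneg fun i hi => h0 i (by simp [hts (Finset.mem_insert_of_mem hi)]))
          (hd j (by simp) k (by simp [hks]) (fun e => hj (e ▸ hks)))
          (iht fun i hi => hts (Finset.mem_insert_of_mem hi))
    rw [Finset.sum_insert hj, ← inf_add_sup, hinf s subset_rfl, zero_add]
    exact sup_le (hle j (by simp)) hs

variable [Module ℝ V] [PosSMulMono ℝ V]

/-- With `C = max c 1`, the infimum lies below both `C • a` and `C • b`; dividing by `C` puts it
below `a ⊓ b = 0`. -/
theorem smul_inf_eq_zero {a b : V} (ha : 0 ≤ a) (hb : 0 ≤ b) (h : a ⊓ b = 0) {c : ℝ}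
    (hc : 0 ≤ c) : (c • a) ⊓ b = 0 := by
  refine le_antisymm ?_ (le_inf (smul_nonneg hc ha) hb)
  set z := (c • a) ⊓ b
  set C := max c 1
  have hC : 0 < C := lt_of_lt_of_le one_pos (le_max_right _ _)
  have hz : z ≤ C • a := inf_le_left.trans <| by
    have := smul_nonneg (sub_nonneg.2 (le_max_left c 1)) ha
    rwa [sub_smul, sub_nonneg] at this
  have hz' : z ≤ C • b := inf_le_right.trans <| by
    have := smul_nonneg (sub_nonneg.2 (le_max_right c 1)) hb
    rwa [sub_smul, sub_nonneg, one_smul] at this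
  have key : C⁻¹ • z ≤ a ⊓ b := by
    refine le_inf ?_ ?_
    · have := smul_le_smul_of_nonneg_left hz (inv_nonneg.2 hC.le)
      rwa [smul_smul, inv_mul_cancel₀ hC.ne', one_smul] at this
    · have := smul_le_smul_of_nonneg_left hz' (inv_nonneg.2 hC.le)
      rwa [smul_smul, inv_mul_cancel₀ hC.ne', one_smul] at this
  rw [h] at key
  have := smul_le_smul_of_nonneg_left key hC.le
  rwa [smul_smul, mul_inv_cancel₀ hC.ne', one_smul, smul_zero] at this

/-- Disjointness is asked only where the coefficient is nonzero, so that the sum may run over a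
family containing `a` itself. -/
theorem inf_sum_smul_eq_zero {ι : Type*} (s : Finset ι) {a : V} (ha : 0 ≤ a) {v : ι → V}
    (hv : ∀ i ∈ s, 0 ≤ v i) {g : ι → ℝ} (hg : ∀ i ∈ s, 0 ≤ g i)
    (h : ∀ i ∈ s, g i ≠ 0 → a ⊓ v i = 0) : a ⊓ ∑ i ∈ s, g i • v i = 0 := by
  classical
  induction s using Finset.induction_on with
  | empty => simpa using ha
  | insert j s hj ih =>
    rw [Finset.sum_insert hj]
    refine inf_add_eq_zero ha (smul_nonneg (hg j (by simp)) (hv j (by simp)))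
      (Finset.sum_nonneg fun i hi => smul_nonneg (hg i (by simp [hi])) (hv i (by simp [hi]))) ?_
      (ih (fun i hi => hv i (by simp [hi])) (fun i hi => hg i (by simp [hi]))
        (fun i hi => h i (by simp [hi])))
    by_cases h0 : g j = 0
    · rw [h0, zero_smul]; exact inf_eq_right.2 ha
    · rw [inf_comm]
      exact smul_inf_eq_zero (hv j (by simp)) ha (by rw [inf_comm]; exact h j (by simp) h0)
        (hg j (by simp))

/-- Move the negative coefficients of a relation to the other side. If `g i > 0`, then `g i • i`
lies below one side and is disjoint from the other, which is equal to it; so it vanishes. -/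
theorem IsDisjointFamily.linearIndependent {s : Finset V} (h : IsDisjointFamily s) :
    LinearIndependent ℝ (Subtype.val : s → V) := by
  classical
  have key : ∀ g : s → ℝ, ∑ i, g i • (i : V) = 0 → ∀ i, ¬ 0 < g i := by
    intro g hg i hi
    have hsum : ∑ j : s, (max (g j) 0) • (j : V) = ∑ j : s, (max (-g j) 0) • (j : V) := by
      rw [← sub_eq_zero, ← Finset.sum_sub_distrib, ← hg]
      refine Finset.sum_congr rfl fun j _ => ?_
      rw [← sub_smul]
      congr 1
      rcases le_total 0 (g j) with h0 | h0
      · rw [max_eq_left h0, max_eq_right (by linarith), sub_zero]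
      · rw [max_eq_right h0, max_eq_left (by linarith)]; ring
    have hle : g i • (i : V) ≤ ∑ j : s, (max (g j) 0) • (j : V) := by
      rw [← max_eq_left hi.le]
      exact Finset.single_le_sum (f := fun j : s => (max (g j) 0) • (j : V))
        (fun j _ => smul_nonneg (le_max_right _ _) (h.nonneg j j.2)) (Finset.mem_univ i)
    have h0 : (i : V) ⊓ ∑ j : s, (max (-g j) 0) • (j : V) = 0 := by
      refine inf_sum_smul_eq_zero (Finset.univ : Finset s) (v := Subtype.val) (h.nonneg i i.2)
        (fun j _ => h.nonneg j j.2)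
        (fun j _ => le_max_right _ _) fun j _ hj => h.inf_eq_zero i i.2 j j.2 ?_
      intro hij
      have hij : i = j := Subtype.ext hij
      subst hij
      exact hj (max_eq_right (by linarith))
    rw [← hsum] at h0
    have h1 : (g i • (i : V)) ⊓ ∑ j : s, (max (g j) 0) • (j : V) = 0 :=
      smul_inf_eq_zero (h.nonneg i i.2) ((smul_nonneg hi.le (h.nonneg i i.2)).trans hle) h0 hi.le
    rw [inf_eq_left.2 hle] at h1
    rcases smul_eq_zero.1 h1 with h2 | h2
    · exact hi.ne' h2
    · exact h.ne_zero i i.2 h2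
  rw [Fintype.linearIndependent_iff]
  intro g hg i
  refine le_antisymm (not_lt.1 (key g hg i)) (neg_nonpos.1 (not_lt.1 (key (fun j => -g j) ?_ i)))
  simpa only [neg_smul, Finset.sum_neg_distrib, neg_eq_zero] using hg

/-- A finite-dimensional Riesz subspace of a Riesz space with a strictly positive functional is
spanned by pairwise disjoint positive elements. -/
theorem exists_isDisjointFamily_span_eq (M : Submodule ℝ V) [FiniteDimensional ℝ M]
    (hM : ∀ v ∈ M, v⁺ ∈ M) (L : V →ₗ[ℝ] ℝ) (hL : ∀ v, 0 ≤ v → 0 ≤ L v)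
    (hL0 : ∀ v, 0 ≤ v → L v = 0 → v = 0) :
    ∃ s : Finset V, IsDisjointFamily s ∧ Submodule.span ℝ (s : Set V) = M := by
  classical
  have hcard : ∀ s : Finset V, IsDisjointFamily s → (s : Set V) ⊆ M →
      s.card ≤ Module.finrank ℝ M := by
    intro s hs hsM
    have hli := hs.linearIndependent
    have := LinearIndependent.of_comp (v := fun i : s => (⟨i, hsM i.2⟩ : M)) M.subtype hli
    simpa using this.fintype_card_le_finrank
  -- Disjoint families are independent, so their size is bounded by the dimension and one of largest
  -- cardinality exists. Its maximality is used twice: members cannot be split, and nothing disjoint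
  -- can be added.
  obtain ⟨s, ⟨hs, hsM⟩, hmax⟩ : ∃ s : Finset V, (IsDisjointFamily s ∧ (s : Set V) ⊆ M) ∧
      ∀ t : Finset V, IsDisjointFamily t → (t : Set V) ⊆ M → t.card ≤ s.card := by
    let S : Set ℕ := {n | ∃ s : Finset V, (IsDisjointFamily s ∧ (s : Set V) ⊆ M) ∧ s.card = n}
    have hne : S.Nonempty := ⟨0, ∅, ⟨⟨by simp, by simp, by simp⟩, by simp⟩, rfl⟩
    have hbdd : BddAbove S := ⟨Module.finrank ℝ M, by
      rintro n ⟨s, ⟨h1, h2⟩, rfl⟩; exact hcard s h1 h2⟩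
    obtain ⟨s, hs, hn⟩ := Nat.sSup_mem hne hbdd
    exact ⟨s, hs, fun t h1 h2 => hn ▸ le_csSup hbdd ⟨t, ⟨h1, h2⟩, rfl⟩⟩
  have hinfM : ∀ u ∈ M, ∀ v ∈ M, u ⊓ v ∈ M := fun u hu v hv => by
    rw [inf_eq_sub_posPart_sub]
    exact M.sub_mem hu (hM _ (M.sub_mem hu hv))
  have hLmono : ∀ u v, u ≤ v → L u ≤ L v := fun u v h => by
    have := hL _ (sub_nonneg.2 h)
    rw [map_sub] at this
    linarith
  have hLpos : ∀ a ∈ s, 0 < L a := fun a ha =>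
    lt_of_le_of_ne (hL a (hs.nonneg a ha)) fun h => hs.ne_zero a ha (hL0 a (hs.nonneg a ha) h.symm)
  -- Members of `s` are atoms of `M`: if `u` were not a multiple of `a`, then `d = u - (L u / L a) •
  -- a` would be nonzero with `L d = 0`. Both `d⁺` and `d⁻` would then be nonzero, disjoint and
  -- below `a`, and replacing `a` by them would enlarge the family.
  have atom : ∀ a ∈ s, ∀ u ∈ M, 0 ≤ u → u ≤ a → u = (L u / L a) • a := by
    intro a ha u hu hu0 hua
    by_contra hne
    set t := L u / L a with ht
    have hLa := hLpos a ha
    have ht0 : 0 ≤ t := div_nonneg (hL u hu0) hLa.le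
    have ht1 : t ≤ 1 := (div_le_one hLa).2 (hLmono u a hua)
    have ha0 := hs.nonneg a ha
    have hta : t • a ≤ a := by
      have := smul_nonneg (sub_nonneg.2 ht1) ha0
      rwa [sub_smul, sub_nonneg, one_smul] at this
    set d := u - t • a with hd
    have hdM : d ∈ M := M.sub_mem hu (M.smul_mem _ (hsM ha))
    have hLd : L d = 0 := by
      rw [hd, map_sub, map_smul, smul_eq_mul, ht, div_mul_cancel₀ _ hLa.ne', sub_self]
    have hpn : d⁺ - d⁻ = d := posPart_sub_negPart d
    have hLpn : L d⁺ = L d⁻ := by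
      have := congrArg L hpn
      rw [map_sub, hLd] at this
      linarith
    have hd0 : d ≠ 0 := fun h => hne (sub_eq_zero.1 h)
    have hp0 : d⁺ ≠ 0 := fun h => hd0 <| by
      have h1 : d⁻ = 0 := hL0 _ (negPart_nonneg d) (by rw [← hLpn, h, map_zero])
      rw [← hpn, h, h1, sub_zero]
    have hn0 : d⁻ ≠ 0 := fun h => hd0 <| by
      have h1 : d⁺ = 0 := hL0 _ (posPart_nonneg d) (by rw [hLpn, h, map_zero])
      rw [← hpn, h, h1, sub_zero]
    have hpa : d⁺ ≤ a := sup_le ((sub_le_self u (smul_nonneg ht0 ha0)).trans hua) ha0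
    have hna : d⁻ ≤ a := by
      refine sup_le ?_ ha0
      rw [hd, neg_sub]
      exact (sub_le_self _ hu0).trans hta
    have hlt : ∀ p, 0 ≤ p → p ≤ a → ∀ b ∈ s.erase a, p ⊓ b = 0 := by
      intro p hp hpa b hb
      refine le_antisymm ?_ (le_inf hp (hs.nonneg b (Finset.mem_of_mem_erase hb)))
      rw [← hs.inf_eq_zero a ha b (Finset.mem_of_mem_erase hb) (Finset.ne_of_mem_erase hb).symm]
      exact inf_le_inf_right b hpa
    have hs' : IsDisjointFamily (s.erase a) :=
      ⟨fun b hb => hs.nonneg b (Finset.mem_of_mem_erase hb),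
        fun b hb => hs.ne_zero b (Finset.mem_of_mem_erase hb),
        fun b hb c hc => hs.inf_eq_zero b (Finset.mem_of_mem_erase hb) c
          (Finset.mem_of_mem_erase hc)⟩
    obtain ⟨hq1, hq2⟩ := hs'.insert (negPart_nonneg d) hn0 (hlt _ (negPart_nonneg d) hna)
    obtain ⟨hp1, hp2⟩ := hq2.insert (posPart_nonneg d) hp0 (by
      intro b hb
      rcases Finset.mem_insert.1 hb with rfl | hb
      · exact posPart_inf_negPart_eq_zero d
      · exact hlt _ (posPart_nonneg d) hpa b hb)
    have hnM : d⁻ ∈ M := by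
      have : d⁻ = d⁺ - d := by rw [eq_sub_iff_add_eq', ← eq_sub_iff_add_eq]; exact hpn.symm
      rw [this]
      exact M.sub_mem (hM d hdM) hdM
    have := hmax _ hp2 (by
      intro b hb
      rcases Finset.mem_insert.1 hb with rfl | hb
      · exact hM d hdM
      rcases Finset.mem_insert.1 hb with rfl | hb
      · exact hnM
      · exact hsM (Finset.mem_of_mem_erase hb))
    rw [Finset.card_insert_of_notMem hp1, Finset.card_insert_of_notMem hq1,
      Finset.card_erase_add_one ha] at this
    omega
  refine ⟨s, hs, le_antisymm (Submodule.span_le.2 hsM) ?_⟩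
  have hpos : ∀ v ∈ M, 0 ≤ v → v ∈ Submodule.span ℝ (s : Set V) := by
    intro v hv hv0
    -- The atomic part of `v` along `a` is extracted by truncating at `c a • a`. Its coefficient `t
    -- a` is at most `L v / L a`; the extra `1` leaves `a ≤ (c a - t a) • a`, which makes the
    -- remainder disjoint from `a`.
    set c : V → ℝ := fun a => L v / L a + 1 with hc
    have hc0 : ∀ a ∈ s, 0 < c a := fun a ha => by
      have := div_nonneg (hL v hv0) (hLpos a ha).le
      simp only [hc]; linarith
    set t : V → ℝ := fun a => L (v ⊓ c a • a) / L a with ht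
    have hu0 : ∀ a ∈ s, 0 ≤ v ⊓ c a • a := fun a ha =>
      le_inf hv0 (smul_nonneg (hc0 a ha).le (hs.nonneg a ha))
    have hut : ∀ a ∈ s, v ⊓ c a • a = t a • a := by
      intro a ha
      have hca := hc0 a ha
      have h1 := atom a ha ((c a)⁻¹ • (v ⊓ c a • a))
        (M.smul_mem _ (hinfM _ hv _ (M.smul_mem _ (hsM ha))))
        (smul_nonneg (inv_nonneg.2 hca.le) (hu0 a ha)) (by
          have := smul_le_smul_of_nonneg_left (inf_le_right : v ⊓ c a • a ≤ c a • a)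
            (inv_nonneg.2 hca.le)
          rwa [smul_smul (c a)⁻¹ (c a), inv_mul_cancel₀ hca.ne', one_smul] at this)
      have h2 := congrArg (fun w => c a • w) h1
      simp only [smul_smul, mul_inv_cancel₀ hca.ne', one_smul, map_smul, smul_eq_mul] at h2
      rw [h2]
      congr 1
      simp only [ht]
      field_simp
    have ht0 : ∀ a ∈ s, 0 ≤ t a := fun a ha => div_nonneg (hL _ (hu0 a ha)) (hLpos a ha).le
    have htc : ∀ a ∈ s, 1 ≤ c a - t a := fun a ha => by
      have : t a ≤ L v / L a := div_le_div_of_nonneg_right (hLmono _ _ inf_le_left) (hLpos a ha).le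
      simp only [hc]
      linarith
    have htv : ∀ a ∈ s, t a • a ≤ v := fun a ha => by rw [← hut a ha]; exact inf_le_left
    have hta0 : ∀ a ∈ s, 0 ≤ t a • a := fun a ha => smul_nonneg (ht0 a ha) (hs.nonneg a ha)
    have hdis : ∀ a ∈ s, ∀ b ∈ s, a ≠ b → (t a • a) ⊓ (t b • b) = 0 := by
      intro a ha b hb hab
      refine smul_inf_eq_zero (hs.nonneg a ha) (hta0 b hb) ?_ (ht0 a ha)
      rw [inf_comm]
      exact smul_inf_eq_zero (hs.nonneg b hb) (hs.nonneg a ha)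
        (hs.inf_eq_zero b hb a ha hab.symm) (ht0 b hb)
    have hsum := sum_le_of_pairwise_inf_eq_zero s hv0 hta0 htv hdis
    set w := v - ∑ a ∈ s, t a • a with hw
    have hw0 : 0 ≤ w := sub_nonneg.2 hsum
    have hsumM : ∑ a ∈ s, t a • a ∈ Submodule.span ℝ (s : Set V) :=
      Submodule.sum_mem _ fun a ha => Submodule.smul_mem _ _ (Submodule.subset_span ha)
    have hwM : w ∈ M := M.sub_mem hv (Submodule.span_le.2 hsM hsumM)
    have hwd : ∀ a ∈ s, w ⊓ a = 0 := by
      intro a ha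
      refine le_antisymm ?_ (le_inf hw0 (hs.nonneg a ha))
      have h1 : w ≤ v - t a • a :=
        sub_le_sub_left (Finset.single_le_sum (f := fun a => t a • a) hta0 ha) v
      have h2 : a ≤ c a • a - t a • a := by
        have := smul_nonneg (sub_nonneg.2 (htc a ha)) (hs.nonneg a ha)
        rwa [sub_smul, sub_nonneg, one_smul, sub_smul] at this
      -- Subtracting `t a • a` from both arguments of `v ⊓ c a • a = t a • a` leaves `0`.
      refine (inf_le_inf h1 h2).trans ?_
      rw [← inf_sub, hut a ha, sub_self]
    have : w = 0 := by
      by_contra hne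
      obtain ⟨h1, h2⟩ := hs.insert hw0 hne hwd
      have := hmax _ h2 (by
        intro b hb
        rcases Finset.mem_insert.1 hb with rfl | hb
        exacts [hwM, hsM hb])
      rw [Finset.card_insert_of_notMem h1] at this
      omega
    rw [sub_eq_zero.1 this]
    exact hsumM
  intro v hv
  have h1 : v⁻ ∈ M := by
    have : v⁻ = (-v)⁺ := (posPart_neg v).symm
    rw [this]
    exact hM _ (M.neg_mem hv)
  rw [← posPart_sub_negPart v]
  exact Submodule.sub_mem _ (hpos _ (hM v hv) (posPart_nonneg v)) (hpos _ h1 (negPart_nonneg v))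

end RieszSpace
end

noncomputable section

namespace FinAddMeasure

variable {X : Type*} [MeasurableSpace X]

/-! ### The lattice structure of `ba(X, Σ)` -/

theorem mono_of_nonneg {μ : FinAddMeasure X} (hμ : 0 ≤ μ) {E F : Set X} (hE : MeasurableSet E)
    (hF : MeasurableSet F) (h : E ⊆ F) : μ E ≤ μ F := by
  have h1 := μ.union' E (F \ E) hE (hF.diff hE) Set.disjoint_sdiff_right
  rw [Set.union_sdiff_cancel h] at h1
  have h2 : 0 ≤ μ (F \ E) := hμ _ (hF.diff hE)
  linarith

theorem apply_compl (μ : FinAddMeasure X) {E : Set X} (hE : MeasurableSet E) :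
    μ Eᶜ = μ Set.univ - μ E := by
  have h1 := μ.union' E Eᶜ hE hE.compl disjoint_compl_right
  rw [Set.union_compl_self] at h1
  linarith

/-- The values of `μ` on the measurable subsets of `E`. -/
def subsetValues (μ : FinAddMeasure X) (E : Set X) : Set ℝ :=
  {r | ∃ F, MeasurableSet F ∧ F ⊆ E ∧ μ F = r}

theorem zero_mem_subsetValues (μ : FinAddMeasure X) (E : Set X) : (0 : ℝ) ∈ μ.subsetValues E :=
  ⟨∅, MeasurableSet.empty, Set.empty_subset _, μ.empty'⟩

theorem subsetValues_le_norm (μ : FinAddMeasure X) (E : Set X) :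
    ∀ r ∈ μ.subsetValues E, r ≤ ‖μ‖ := by
  rintro _ ⟨F, hF, -, rfl⟩
  exact (le_abs_self _).trans (abs_apply_le_norm μ F hF)

theorem le_sSup_subsetValues (μ : FinAddMeasure X) {E F : Set X} (hF : MeasurableSet F)
    (h : F ⊆ E) : μ F ≤ sSup (μ.subsetValues E) :=
  le_csSup ⟨‖μ‖, μ.subsetValues_le_norm E⟩ ⟨F, hF, h, rfl⟩

open Classical in
/-- The positive part of a finitely additive measure. -/
def positivePart (μ : FinAddMeasure X) : FinAddMeasure X where
  toFun E := if MeasurableSet E then sSup (μ.subsetValues E) else 0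
  not_measurable' E hE := if_neg hE
  empty' := by
    rw [if_pos MeasurableSet.empty]
    refine le_antisymm (csSup_le ⟨0, μ.zero_mem_subsetValues ∅⟩ ?_) ?_
    · rintro _ ⟨F, hF, hFE, rfl⟩
      rw [Set.subset_empty_iff.1 hFE, μ.empty']
    · simpa only [μ.empty'] using μ.le_sSup_subsetValues MeasurableSet.empty (Set.empty_subset ∅)
  union' E F hE hF h := by
    rw [if_pos (hE.union hF), if_pos hE, if_pos hF]
    refine le_antisymm (csSup_le ⟨0, μ.zero_mem_subsetValues _⟩ ?_) ?_
    · rintro _ ⟨G, hG, hGE, rfl⟩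
      have h1 : G = G ∩ E ∪ G ∩ F := by
        rw [← Set.inter_union_distrib_left, Set.inter_eq_left.2 hGE]
      rw [h1, μ.union' _ _ (hG.inter hE) (hG.inter hF)
        (h.mono Set.inter_subset_right Set.inter_subset_right)]
      exact add_le_add (μ.le_sSup_subsetValues (hG.inter hE) Set.inter_subset_right)
        (μ.le_sSup_subsetValues (hG.inter hF) Set.inter_subset_right)
    · rw [← le_sub_iff_add_le]
      refine csSup_le ⟨0, μ.zero_mem_subsetValues _⟩ ?_
      rintro _ ⟨G, hG, hGE, rfl⟩
      rw [le_sub_iff_add_le, ← le_sub_iff_add_le']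
      refine csSup_le ⟨0, μ.zero_mem_subsetValues _⟩ ?_
      rintro _ ⟨G', hG', hGE', rfl⟩
      rw [le_sub_iff_add_le', ← μ.union' G G' hG hG' (h.mono hGE hGE')]
      exact μ.le_sSup_subsetValues (hG.union hG') (Set.union_subset_union hGE hGE')
  bounded' := by
    refine ⟨‖μ‖, fun E => ?_⟩
    split_ifs with hE
    · rw [abs_of_nonneg (by
        simpa only [μ.empty'] using
          μ.le_sSup_subsetValues MeasurableSet.empty (Set.empty_subset E))]
      exact csSup_le ⟨0, μ.zero_mem_subsetValues _⟩ (μ.subsetValues_le_norm E)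
    · simp

theorem positivePart_apply (μ : FinAddMeasure X) {E : Set X} (hE : MeasurableSet E) :
    μ.positivePart E = sSup (μ.subsetValues E) := if_pos hE

theorem le_positivePart (μ : FinAddMeasure X) : μ ≤ μ.positivePart := fun E hE => by
  rw [positivePart_apply μ hE]
  exact μ.le_sSup_subsetValues hE subset_rfl

theorem positivePart_nonneg (μ : FinAddMeasure X) : 0 ≤ μ.positivePart := fun E hE => by
  rw [positivePart_apply μ hE, zero_apply]
  simpa only [μ.empty'] using μ.le_sSup_subsetValues MeasurableSet.empty (Set.empty_subset E)

theorem positivePart_le {μ ν : FinAddMeasure X} (h : μ ≤ ν) (h0 : 0 ≤ ν) :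
    μ.positivePart ≤ ν := fun E hE => by
  rw [positivePart_apply μ hE]
  refine csSup_le ⟨0, μ.zero_mem_subsetValues _⟩ ?_
  rintro _ ⟨F, hF, hFE, rfl⟩
  exact (h F hF).trans (mono_of_nonneg h0 hF hE hFE)

instance : IsOrderedAddMonoid (FinAddMeasure X) where
  add_le_add_left μ ν h ρ E hE := by
    simpa only [add_apply, add_le_add_iff_right] using h E hE

instance : PosSMulMono ℝ (FinAddMeasure X) where
  smul_le_smul_of_nonneg_left _ hc _ _ h E hE := mul_le_mul_of_nonneg_left (h E hE) hc

/-- In an ordered group the positive part determines both operations. The order is the setwise one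
already defined, so an infimum equal to `0` gives disjointness in the sense of `IsDisjoint`. -/
instance : Lattice (FinAddMeasure X) where
  sup μ ν := (μ - ν).positivePart + ν
  le_sup_left _ _ := sub_le_iff_le_add.1 (le_positivePart _)
  le_sup_right _ _ := le_add_of_nonneg_left (positivePart_nonneg _)
  sup_le _ ν _ h h' := le_sub_iff_add_le.1
    (positivePart_le (sub_le_sub_right h ν) (sub_nonneg.2 h'))
  inf μ ν := μ - (μ - ν).positivePart
  inf_le_left _ _ := sub_le_self _ (positivePart_nonneg _)
  inf_le_right _ _ := sub_le_comm.1 (le_positivePart _)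
  le_inf _ ν _ h h' := le_sub_comm.1
    (positivePart_le (sub_le_sub_left h' ν) (sub_nonneg.2 h))

/-- The total mass as a linear functional. -/
def totalMass : FinAddMeasure X →ₗ[ℝ] ℝ where
  toFun μ := μ Set.univ
  map_add' _ _ := rfl
  map_smul' _ _ := rfl

theorem eq_zero_of_nonneg_of_univ {μ : FinAddMeasure X} (hμ : 0 ≤ μ) (h : μ Set.univ = 0) :
    μ = 0 :=
  ext_of_measurable fun E hE =>
    le_antisymm ((mono_of_nonneg hμ hE MeasurableSet.univ (Set.subset_univ E)).trans h.le) (hμ E hE)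

theorem isDisjoint_of_inf_eq_zero {μ ν : FinAddMeasure X} (h : μ ⊓ ν = 0) : μ.IsDisjoint ν := by
  unfold IsDisjoint
  rw [← h]
  exact isGLB_pair

/-! ### Positivity of the integral -/

theorem integral_one (μ : FinAddMeasure X) : μ.integral (fun _ => 1) = μ Set.univ := by
  refine integral_eq_of_approx μ (isBddMeas_const 1) (C := 0) fun ε hε =>
    ⟨SimpleFunc.const X 1, fun x => by simpa using hε.le, ?_⟩
  have h1 : (1 : X → ℝ) ⁻¹' {1} = Set.univ := by ext; simp
  rcases isEmpty_or_nonempty X with hX | hX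
  · simp [simpleIntegral, Set.eq_empty_of_isEmpty (Set.univ : Set X), μ.empty']
  · simp [simpleIntegral, h1]

/-- If `0 ≤ f ≤ C` then `|f - C| ≤ C`, so the norm bound gives `∫ (f - C) ≥ -C μ(X)`, and adding `C
μ(X)` leaves `∫ f ≥ 0`. -/
theorem integral_nonneg {μ : FinAddMeasure X} (hμ : 0 ≤ μ) {f : X → ℝ} (hf : IsBddMeas f)
    (h0 : ∀ x, 0 ≤ f x) : 0 ≤ μ.integral f := by
  obtain ⟨C, hC⟩ := hf.2
  have hfC : ∀ x, f x ≤ C := fun x => (le_abs_self _).trans (hC x)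
  have h1 := integral_add μ hf (isBddMeas_const (X := X) (-C))
  have h2 : μ.integral (fun _ => -C) = -C * μ.integral (fun _ => 1) := by
    simpa using integral_const_mul μ (-C) (isBddMeas_const (X := X) 1)
  have h4 := abs_le.1 (abs_integral_le μ (hf.add (isBddMeas_const (-C))) (C := C) fun x => by
    rw [abs_le]; constructor <;> linarith [h0 x, hfC x])
  rw [norm_eq_of_nonneg μ hμ] at h4
  rw [h1, h2, integral_one] at h4
  linarith [h4.1]

end FinAddMeasure

open FinAddMeasure

variable {X : Type*} [MeasurableSpace X]

/-! ### The invariant measures form a Riesz subspace -/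

theorem markovOp_nonneg (κ : Kernel X X) [IsMarkovKernel κ] {μ : FinAddMeasure X} (hμ : 0 ≤ μ) :
    0 ≤ markovOp κ μ := fun E hE => by
  rw [markovOp_apply κ μ hE]
  exact integral_nonneg hμ (isBddMeas_kernel κ hE) fun x => measureReal_nonneg

theorem markovOp_univ (κ : Kernel X X) [IsMarkovKernel κ] (μ : FinAddMeasure X) :
    markovOp κ μ Set.univ = μ Set.univ := by
  rw [markovOp_apply κ μ MeasurableSet.univ]
  simpa using integral_one μ

/-- Positivity gives `μ⁺ ≤ A μ⁺`. The two sides have the same total mass, and a nonnegative measure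
of mass zero vanishes. -/
theorem posPart_mem_invariantSpace (κ : Kernel X X) [IsMarkovKernel κ] {μ : FinAddMeasure X}
    (hμ : μ ∈ invariantSpace κ) : μ⁺ ∈ invariantSpace κ := by
  have hμ : markovOp κ μ = μ := hμ
  have h1 : μ⁺ ≤ markovOp κ μ⁺ := by
    refine sup_le ?_ (markovOp_nonneg κ (posPart_nonneg μ))
    have := markovOp_nonneg κ (sub_nonneg.2 (le_posPart μ))
    rwa [map_sub, hμ, sub_nonneg] at this
  have h2 : markovOp κ μ⁺ - μ⁺ = 0 :=
    eq_zero_of_nonneg_of_univ (sub_nonneg.2 h1)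
      (by rw [FinAddMeasure.sub_apply, markovOp_univ, sub_self])
  exact sub_eq_zero.1 h2

/-- Total mass is the strictly positive functional to which the Riesz space result is applied;
scaling to mass one keeps independence, span and disjointness. -/
theorem exists_isDisjointBasis (κ : Kernel X X) [IsMarkovKernel κ] (h : ConditionDoubleStar κ) :
    ∃ (m : ℕ) (H : Fin m → FinAddMeasure X), IsDisjointBasis κ H := by
  have : FiniteDimensional ℝ (invariantSpace κ) := h
  obtain ⟨s, hs, hspan⟩ := exists_isDisjointFamily_span_eq (invariantSpace κ)
    (fun v hv => posPart_mem_invariantSpace κ hv) totalMass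
    (fun v hv => hv _ MeasurableSet.univ) (fun v hv h => eq_zero_of_nonneg_of_univ hv h)
  have hpos : ∀ a ∈ s, 0 < a Set.univ := fun a ha =>
    lt_of_le_of_ne (hs.nonneg a ha _ MeasurableSet.univ) fun h0 =>
      hs.ne_zero a ha (eq_zero_of_nonneg_of_univ (hs.nonneg a ha) h0.symm)
  let e := s.equivFin.symm
  have hmem : ∀ i, (e i : FinAddMeasure X) ∈ s := fun i => (e i).2
  -- The normalising weights are taken as units so that independence survives rescaling by
  -- `units_smul`.
  let w : Fin s.card → ℝˣ := fun i => Units.mk0 ((e i : FinAddMeasure X) Set.univ)⁻¹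
    (inv_ne_zero (hpos _ (hmem i)).ne')
  have hw : ∀ i, 0 ≤ (w i : ℝ) := fun i => inv_nonneg.2 (hpos _ (hmem i)).le
  have hnn : ∀ i, 0 ≤ w i • (e i : FinAddMeasure X) := fun i => by
    rw [Units.smul_def]
    exact smul_nonneg (hw i) (hs.nonneg _ (hmem i))
  refine ⟨s.card, fun i => w i • (e i : FinAddMeasure X), fun i => ⟨hnn i, ?_⟩, ?_, ?_, ?_⟩
  · rw [norm_eq_of_nonneg _ (hnn i)]
    exact inv_mul_cancel₀ (hpos _ (hmem i)).ne'
  · exact (hs.linearIndependent.comp e e.injective).units_smul w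
  · rw [← hspan]
    refine le_antisymm (Submodule.span_le.2 ?_) (Submodule.span_le.2 ?_)
    · rintro _ ⟨i, rfl⟩
      exact Submodule.smul_mem _ (w i : ℝ) (Submodule.subset_span (hmem i))
    · intro a ha
      obtain ⟨i, hi⟩ := e.surjective ⟨a, ha⟩
      have h1 : w i • (e i : FinAddMeasure X) ∈ Submodule.span ℝ
          (Set.range fun i => w i • (e i : FinAddMeasure X)) :=
        Submodule.subset_span ⟨i, rfl⟩
      have h2 := Submodule.smul_mem _ ((w i)⁻¹ : ℝ) h1
      rw [Units.smul_def, smul_smul, inv_mul_cancel₀ (w i).ne_zero, one_smul, hi] at h2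
      exact h2
  · intro i j hij
    refine isDisjoint_of_inf_eq_zero (smul_inf_eq_zero (hs.nonneg _ (hmem i)) (hnn j) ?_ (hw i))
    rw [inf_comm]
    refine smul_inf_eq_zero (hs.nonneg _ (hmem j)) (hs.nonneg _ (hmem i)) ?_ (hw j)
    exact hs.inf_eq_zero _ (hmem j) _ (hmem i) fun h => hij (e.injective (Subtype.ext h)).symm

end

noncomputable section

namespace FinAddMeasure

variable {X : Type*} [MeasurableSpace X]

/-! ### Finite measures as elements of `ca(X, Σ)` -/

open Classical in
/-- The finitely additive measure given by a finite measure. -/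
def ofMeasure (m : Measure X) [IsFiniteMeasure m] : FinAddMeasure X where
  toFun E := if MeasurableSet E then m.real E else 0
  not_measurable' E hE := if_neg hE
  empty' := by simp
  union' E F hE hF h := by
    rw [if_pos (hE.union hF), if_pos hE, if_pos hF, measureReal_union h hF]
  bounded' := by
    refine ⟨m.real Set.univ, fun E => ?_⟩
    split_ifs
    · rw [abs_of_nonneg measureReal_nonneg]
      exact measureReal_mono (Set.subset_univ E)
    · simp

theorem ofMeasure_apply (m : Measure X) [IsFiniteMeasure m] {E : Set X} (hE : MeasurableSet E) :
    ofMeasure m E = m.real E := if_pos hE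

theorem ofMeasure_nonneg (m : Measure X) [IsFiniteMeasure m] : 0 ≤ ofMeasure m := fun E hE => by
  rw [ofMeasure_apply m hE]
  exact measureReal_nonneg

theorem ofMeasure_mem_caSubspace (m : Measure X) [IsFiniteMeasure m] :
    ofMeasure m ∈ caSubspace X := fun E hE hd => by
  have := m.toSignedMeasure.m_iUnion hE hd
  rw [ofMeasure_apply m (MeasurableSet.iUnion hE), funext fun i => ofMeasure_apply m (hE i)]
  simpa only [Measure.toSignedMeasure_apply_measurable (hE _),
    Measure.toSignedMeasure_apply_measurable (MeasurableSet.iUnion hE)] using this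

theorem integral_ofMeasure (m : Measure X) [IsFiniteMeasure m] {f : X → ℝ} (hf : IsBddMeas f) :
    (ofMeasure m).integral f = ∫ x, f x ∂m := by
  refine integral_eq_of_approx _ hf (C := m.real Set.univ) fun ε hε => ?_
  obtain ⟨g, hg⟩ := exists_simple_approx hf hε
  refine ⟨g, hg, ?_⟩
  have h1 : (ofMeasure m).simpleIntegral g = ∫ x, g x ∂m := by
    rw [g.integral_eq_sum g.integrable_of_isFiniteMeasure]
    refine Finset.sum_congr rfl fun y _ => ?_
    rw [ofMeasure_apply m (g.measurableSet_fiber y), smul_eq_mul, mul_comm]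
  obtain ⟨hfm, C, hC⟩ := hf
  have hfi : Integrable f m := Integrable.of_bound hfm.aestronglyMeasurable C
    (ae_of_all _ fun x => by simpa using hC x)
  rw [h1, ← MeasureTheory.integral_sub g.integrable_of_isFiniteMeasure hfi, ← Real.norm_eq_abs]
  exact norm_integral_le_of_norm_le_const (ae_of_all _ fun x => by simpa using hg x)

/-! ### Limits of finitely additive measures -/

/-- A bounded sequence of finitely additive measures has a setwise limit along every ultrafilter. -/
theorem exists_tendsto_ultrafilter (σ : ℕ → FinAddMeasure X) {C : ℝ} (hσ : ∀ n, ‖σ n‖ ≤ C)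
    (U : Ultrafilter ℕ) :
    ∃ ν : FinAddMeasure X, ∀ E, Tendsto (fun n => σ n E) U (𝓝 (ν E)) := by
  have hC : 0 ≤ C := (norm_nonneg _).trans (hσ 0)
  have hb : ∀ n E, |σ n E| ≤ C := fun n E => by
    by_cases hE : MeasurableSet E
    · exact (abs_apply_le_norm _ E hE).trans (hσ n)
    · rw [(σ n).not_measurable' E hE, abs_zero]; exact hC
  -- Compactness of `[-C, C]` gives a limit for each set separately; additivity passes to the limit
  -- because only two sets are involved at a time.
  have hlim : ∀ E, ∃ r ∈ Set.Icc (-C) C, Tendsto (fun n => σ n E) U (𝓝 r) := fun E =>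
    isCompact_Icc.ultrafilter_le_nhds (U.map fun n => σ n E)
      (le_principal_iff.2 (Filter.mem_map.2 (Eventually.of_forall fun n => abs_le.1 (hb n E))))
  choose ν hν hlim using hlim
  refine ⟨⟨ν, fun E hE => ?_, ?_, fun E F hE hF h => ?_, C, fun E => abs_le.2 (hν E)⟩, hlim⟩
  · refine tendsto_nhds_unique (hlim E) ?_
    simp [fun n => (σ n).not_measurable' E hE]
  · refine tendsto_nhds_unique (hlim ∅) ?_
    simp [fun n => (σ n).empty']
  · refine tendsto_nhds_unique (hlim (E ∪ F)) ?_
    simpa only [fun n => (σ n).union' E F hE hF h] using (hlim E).add (hlim F)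

/-- Against a simple function this is a finite sum of setwise limits; the uniform norm bound
controls the error of a uniform simple approximation. -/
theorem tendsto_integral {ι : Type*} {l : Filter ι} {σ : ι → FinAddMeasure X} {C : ℝ}
    (hσ : ∀ n, ‖σ n‖ ≤ C) {ν : FinAddMeasure X}
    (h : ∀ E, Tendsto (fun n => σ n E) l (𝓝 (ν E))) {f : X → ℝ} (hf : IsBddMeas f) :
    Tendsto (fun n => (σ n).integral f) l (𝓝 (ν.integral f)) := by
  rcases l.eq_or_neBot with rfl | hl
  · exact tendsto_bot
  have hC : 0 ≤ C := (norm_nonneg _).trans (hσ hl.nonempty.some)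
  rw [Metric.tendsto_nhds]
  intro ε hε
  have hD : 0 < C + ‖ν‖ + 1 := by have := norm_nonneg ν; linarith
  set δ := ε / (2 * (C + ‖ν‖ + 1)) with hδ
  have hδ0 : 0 < δ := by positivity
  have hδε : δ * (2 * (C + ‖ν‖ + 1)) = ε := by rw [hδ]; field_simp
  obtain ⟨g, hg⟩ := exists_simple_approx hf hδ0
  have hsi : Tendsto (fun n => (σ n).simpleIntegral g) l (𝓝 (ν.simpleIntegral g)) :=
    tendsto_finsetSum _ fun y _ => (h _).const_mul y
  filter_upwards [Metric.tendsto_nhds.1 hsi (ε / 2) (half_pos hε)] with n hn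
  rw [Real.dist_eq] at hn ⊢
  have h1 := abs_le.1 (abs_simpleIntegral_sub_integral_le (σ n) hf g hg)
  have h2 := abs_le.1 (abs_simpleIntegral_sub_integral_le ν hf g hg)
  have h3 := abs_lt.1 hn
  have h4 : δ * ‖σ n‖ ≤ δ * C := mul_le_mul_of_nonneg_left (hσ n) hδ0.le
  rw [abs_lt]
  constructor <;> nlinarith [h1.1, h1.2, h2.1, h2.2, h3.1, h3.2]

theorem tendsto_of_antitone {μ : FinAddMeasure X} (hμ : μ ∈ caSubspace X) {F : ℕ → Set X}
    (hF : ∀ n, MeasurableSet (F n)) (hanti : Antitone F) (hempty : ⋂ n, F n = ∅) :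
    Tendsto (fun n => μ (F n)) atTop (𝓝 0) := by
  have := VectorMeasure.tendsto_vectorMeasure_iInter_atTop_nat (v := μ.toSignedMeasure hμ)
    hanti hF
  rw [hempty, VectorMeasure.empty] at this
  exact this

/-- Continuity at `∅` along decreasing sequences suffices: apply it to the tails `⋃ i ≥ n, E i` of a
disjoint sequence. -/
theorem mem_caSubspace_of_tendsto {μ : FinAddMeasure X} (hμ : 0 ≤ μ)
    (h : ∀ F : ℕ → Set X, (∀ n, MeasurableSet (F n)) → Antitone F → ⋂ n, F n = ∅ →
      Tendsto (fun n => μ (F n)) atTop (𝓝 0)) : μ ∈ caSubspace X := by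
  intro E hE hd
  rw [hasSum_iff_tendsto_nat_of_nonneg fun i => hμ (E i) (hE i)]
  have hF := h (fun n => ⋃ i ≥ n, E i)
    (fun n => MeasurableSet.iUnion fun i => MeasurableSet.iUnion fun _ => hE i)
    (fun m n hmn => Set.biUnion_subset_biUnion_left fun i hi => le_trans hmn hi) (by
      ext x
      simp only [Set.mem_iInter, Set.mem_iUnion, Set.mem_empty_iff_false, iff_false, not_forall]
      by_cases hx : ∃ i, x ∈ E i
      · obtain ⟨i, hi⟩ := hx
        refine ⟨i + 1, ?_⟩
        rintro ⟨j, hj, hxj⟩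
        exact Set.disjoint_left.1 (hd (show i ≠ j by have : i + 1 ≤ j := hj; omega)) hi hxj
      · exact ⟨0, fun ⟨j, _, hj⟩ => hx ⟨j, hj⟩⟩)
  have hsum : ∀ n, ∑ i ∈ Finset.range n, μ (E i) = μ (⋃ i, E i) - μ (⋃ i ≥ n, E i) := by
    intro n
    have h1 : MeasurableSet (⋃ i ∈ Finset.range n, E i) :=
      Finset.measurableSet_biUnion _ fun i _ => hE i
    have h2 : MeasurableSet (⋃ i ≥ n, E i) :=
      MeasurableSet.iUnion fun i => MeasurableSet.iUnion fun _ => hE i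
    have h3 : ⋃ i, E i = (⋃ i ∈ Finset.range n, E i) ∪ ⋃ i ≥ n, E i := by
      ext x
      simp only [Set.mem_iUnion, Set.mem_union, Finset.mem_range, ge_iff_le, exists_prop]
      constructor
      · rintro ⟨i, hi⟩
        rcases lt_or_ge i n with hin | hin
        exacts [Or.inl ⟨i, hin, hi⟩, Or.inr ⟨i, hin, hi⟩]
      · rintro (⟨i, -, hi⟩ | ⟨i, -, hi⟩) <;> exact ⟨i, hi⟩
    have h4 : Disjoint (⋃ i ∈ Finset.range n, E i) (⋃ i ≥ n, E i) := by
      simp only [Set.disjoint_iUnion_left, Set.disjoint_iUnion_right]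
      intro j hj i hi
      exact hd (by have := Finset.mem_range.1 hi; have : n ≤ j := hj; omega)
    rw [h3, μ.union' _ _ h1 h2 h4, sum_apply_biUnion μ _ _ (fun i _ => hE i)
      (fun i _ j _ hij => hd hij)]
    ring
  rw [funext hsum]
  simpa using hF.const_sub (μ (⋃ i, E i))

/-- Nikodym's theorem for nonnegative measures: a setwise limit of countably additive measures is
countably additive. -/
theorem mem_caSubspace_of_setwise_tendsto {σ : ℕ → FinAddMeasure X} (hσ : ∀ n, 0 ≤ σ n)
    (hca : ∀ n, σ n ∈ caSubspace X) {μ : FinAddMeasure X}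
    (h : ∀ E, MeasurableSet E → Tendsto (fun n => σ n E) atTop (𝓝 (μ E))) :
    μ ∈ caSubspace X := by
  have hμ : 0 ≤ μ := fun E hE => ge_of_tendsto' (h E hE) fun n => hσ n E hE
  refine mem_caSubspace_of_tendsto hμ fun F hF hanti hempty => ?_
  have hmono : Antitone fun n => μ (F n) := fun m n hmn =>
    mono_of_nonneg hμ (hF n) (hF m) (hanti hmn)
  have hbdd : BddBelow (Set.range fun n => μ (F n)) :=
    ⟨0, by rintro _ ⟨n, rfl⟩; exact hμ _ (hF n)⟩
  have hlim := tendsto_atTop_ciInf hmono hbdd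
  set a := ⨅ n, μ (F n) with ha
  have ha0 : 0 ≤ a := le_ciInf fun n => hμ _ (hF n)
  rcases ha0.eq_or_lt with ha' | hapos
  · rwa [← ha'] at hlim
  exfalso
  have hage : ∀ n, a ≤ μ (F n) := fun n => ciInf_le hbdd n
  -- Gliding hump. If `μ (F n)` decreased to `a > 0`, some late `σ n` would give `F m` more than
  -- `7a/8`, while its countable additivity leaves less than `a/8` on a later `F m'`; the difference
  -- set carries more than `3a/4`.
  have hstep : ∀ m N : ℕ, ∃ n m' : ℕ, N ≤ n ∧ m < m' ∧ 3 / 4 * a < σ n (F m \ F m') := by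
    intro m N
    obtain ⟨n, hn, hnN⟩ := (((h _ (hF m)).eventually
      (lt_mem_nhds (show 7 / 8 * a < μ (F m) by linarith [hage m]))).and
      (eventually_ge_atTop N)).exists
    obtain ⟨m', hm', hmm'⟩ := (((tendsto_of_antitone (hca n) hF hanti hempty).eventually
      (gt_mem_nhds (show 0 < a / 8 by linarith))).and (eventually_gt_atTop m)).exists
    refine ⟨n, m', hnN, hmm', ?_⟩
    have := (σ n).union' (F m') (F m \ F m') (hF m') ((hF m).diff (hF m'))
      Set.disjoint_sdiff_right
    rw [Set.union_sdiff_cancel (hanti hmm'.le)] at this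
    linarith
  choose nn next hnn hnext hblock using hstep
  -- Starting where `μ (F m₀) < 5a/4` leaves no room for two disjoint sets of `μ`-measure `3a/4`.
  obtain ⟨m₀, hm₀⟩ := (hlim.eventually (gt_mem_nhds (show a < 5 / 4 * a by linarith))).exists
  let M : ℕ → ℕ := fun j => Nat.rec m₀ (fun j m => next m j) j
  have hMs : ∀ j, M (j + 1) = next (M j) j := fun j => rfl
  have hM : StrictMono M := strictMono_nat_of_lt_succ fun j => by rw [hMs]; exact hnext _ _
  set B : ℕ → Set X := fun j => F (M j) \ F (M (j + 1)) with hB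
  have hBm : ∀ j, MeasurableSet (B j) := fun j => (hF _).diff (hF _)
  have hBlt : ∀ i j, i < j → Disjoint (B i) (B j) := fun i j hij =>
    Set.disjoint_left.2 fun x hx hx' => hx.2 (hanti (hM.monotone hij) hx'.1)
  have hBd : ∀ i j, i ≠ j → Disjoint (B i) (B j) := fun i j hij => by
    rcases lt_or_gt_of_ne hij with h1 | h1
    exacts [hBlt i j h1, (hBlt j i h1).symm]
  have hBσ : ∀ j, ∃ n, j ≤ n ∧ 3 / 4 * a < σ n (B j) := fun j =>
    ⟨nn (M j) j, hnn _ _, hblock (M j) j⟩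
  -- A union of infinitely many blocks contains a hump of `σ n` for arbitrarily large `n`, so its
  -- limit measure is at least `3a/4`. The even and the odd blocks then contradict the choice of
  -- `m₀`.
  have hbig : ∀ f : ℕ → ℕ, (∀ j, j ≤ f j) → 3 / 4 * a ≤ μ (⋃ j, B (f j)) := by
    intro f hf
    have hm : MeasurableSet (⋃ j, B (f j)) := MeasurableSet.iUnion fun j => hBm _
    by_contra hlt
    obtain ⟨N, hN⟩ := eventually_atTop.1 ((h _ hm).eventually (gt_mem_nhds (not_le.1 hlt)))
    obtain ⟨n, hn, hn'⟩ := hBσ (f N)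
    have h1 := hN n ((hf N).trans hn)
    have h2 := mono_of_nonneg (hσ n) (hBm (f N)) hm (Set.subset_iUnion (fun j => B (f j)) N)
    linarith
  have h1 := hbig (fun j => 2 * j) fun j => by omega
  have h2 := hbig (fun j => 2 * j + 1) fun j => by omega
  have hm1 : MeasurableSet (⋃ j, B (2 * j)) := MeasurableSet.iUnion fun j => hBm (2 * j)
  have hm2 : MeasurableSet (⋃ j, B (2 * j + 1)) :=
    MeasurableSet.iUnion fun j => hBm (2 * j + 1)
  have h3 := μ.union' _ _ hm1 hm2 (by
    simp only [Set.disjoint_iUnion_left, Set.disjoint_iUnion_right]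
    intro i j
    exact hBd (2 * j) (2 * i + 1) (by omega))
  have hsub : ∀ j, B j ⊆ F m₀ := fun j => Set.sdiff_subset.trans (hanti (hM.monotone j.zero_le))
  have h4 := mono_of_nonneg hμ (hm1.union hm2) (hF m₀)
    (Set.union_subset (Set.iUnion_subset fun j => hsub (2 * j))
      (Set.iUnion_subset fun j => hsub (2 * j + 1)))
  linarith

end FinAddMeasure

open FinAddMeasure

variable {X : Type*} [MeasurableSpace X]

/-! ### Iterates of the kernel and their Cesàro means -/

instance isMarkovKernel_pow (κ : Kernel X X) [IsMarkovKernel κ] (n : ℕ) :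
    IsMarkovKernel (κ ^ n) := by
  induction n with
  | zero => rw [pow_zero]; exact inferInstanceAs (IsMarkovKernel Kernel.id)
  | succ n ih => rw [Kernel.pow_add]; rw [pow_one]; infer_instance

theorem kernel_pow_add_real (κ : Kernel X X) [IsMarkovKernel κ] (m n : ℕ) (x : X) {E : Set X}
    (hE : MeasurableSet E) :
    ((κ ^ (m + n)) x).real E = ∫ y, ((κ ^ n) y).real E ∂((κ ^ m) x) := by
  rw [integral_kernel_real _ _ hE, add_comm, Kernel.pow_add, Kernel.comp_apply]

theorem markovOp_ofMeasure_pow (κ : Kernel X X) [IsMarkovKernel κ] (n : ℕ) (x : X) :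
    markovOp κ (ofMeasure ((κ ^ n) x)) = ofMeasure ((κ ^ (n + 1)) x) :=
  ext_of_measurable fun E hE => by
    rw [markovOp_apply κ _ hE, integral_ofMeasure _ (isBddMeas_kernel κ hE), ofMeasure_apply _ hE,
      kernel_pow_add_real κ n 1 x hE, pow_one]

/-- The Cesàro mean `(1/n) ∑_{k=1}^n p^k(x, ·)`. -/
def cesaroMean (κ : Kernel X X) [IsMarkovKernel κ] (n : ℕ) (x : X) : FinAddMeasure X :=
  (1 / (n : ℝ)) • ∑ k ∈ Finset.Icc 1 n, ofMeasure ((κ ^ k) x)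

theorem FinAddMeasure.sum_apply {ι : Type*} (s : Finset ι) (μ : ι → FinAddMeasure X) (E : Set X) :
    (∑ i ∈ s, μ i) E = ∑ i ∈ s, μ i E := by
  have := congrFun (map_sum (coeHom (X := X)) μ s) E
  rwa [Finset.sum_apply] at this

theorem cesaroMean_apply (κ : Kernel X X) [IsMarkovKernel κ] (n : ℕ) (x : X) {E : Set X}
    (hE : MeasurableSet E) :
    cesaroMean κ n x E = (1 / (n : ℝ)) * ∑ k ∈ Finset.Icc 1 n, ((κ ^ k) x).real E := by
  rw [cesaroMean, FinAddMeasure.smul_apply, FinAddMeasure.sum_apply]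
  simp only [ofMeasure_apply _ hE]

theorem cesaroMean_nonneg (κ : Kernel X X) [IsMarkovKernel κ] (n : ℕ) (x : X) :
    0 ≤ cesaroMean κ n x :=
  smul_nonneg (by positivity) (Finset.sum_nonneg fun _ _ => ofMeasure_nonneg _)

theorem cesaroMean_mem_caSubspace (κ : Kernel X X) [IsMarkovKernel κ] (n : ℕ) (x : X) :
    cesaroMean κ n x ∈ caSubspace X :=
  Submodule.smul_mem _ _ (Submodule.sum_mem _ fun _ _ => ofMeasure_mem_caSubspace _)

theorem cesaroMean_univ (κ : Kernel X X) [IsMarkovKernel κ] (n : ℕ) (x : X) :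
    cesaroMean κ (n + 1) x Set.univ = 1 := by
  rw [cesaroMean_apply κ _ x MeasurableSet.univ]
  simp only [probReal_univ, Finset.sum_const, Nat.card_Icc, nsmul_eq_mul, mul_one]
  push_cast
  field_simp

/-- The operator shifts `p^k` to `p^(k+1)`, so the sum telescopes; the difference vanishes as `n →
∞`, uniformly in the starting point. -/
theorem markovOp_cesaroMean_sub (κ : Kernel X X) [IsMarkovKernel κ] (n : ℕ) (x : X) :
    markovOp κ (cesaroMean κ n x) - cesaroMean κ n x =
      (1 / (n : ℝ)) • (ofMeasure ((κ ^ (n + 1)) x) - ofMeasure ((κ ^ 1) x)) := by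
  rw [cesaroMean, map_smul, map_sum, ← smul_sub, ← Finset.sum_sub_distrib]
  congr 1
  simp only [markovOp_ofMeasure_pow]
  rw [← Finset.Ico_add_one_right_eq_Icc]
  exact Finset.sum_Ico_sub (fun k => ofMeasure ((κ ^ k) x)) (by omega)

/-- Setwise limits of Cesàro means along an ultrafilter are invariant probabilities. -/
theorem exists_invariantProb_tendsto (κ : Kernel X X) [IsMarkovKernel κ] (x : ℕ → X)
    (U : Ultrafilter ℕ) (hU : (U : Filter ℕ) ≤ atTop) :
    ∃ ν ∈ invariantProb κ, ∀ E,
      Tendsto (fun n => cesaroMean κ (n + 1) (x n) E) U (𝓝 (ν E)) := by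
  have hn : ∀ n, ‖cesaroMean κ (n + 1) (x n)‖ ≤ 1 := fun n => by
    rw [norm_eq_of_nonneg _ (cesaroMean_nonneg κ _ _), cesaroMean_univ]
  obtain ⟨ν, hν⟩ := exists_tendsto_ultrafilter _ hn U
  have hν0 : 0 ≤ ν := fun E hE => ge_of_tendsto' (hν E) fun n => cesaroMean_nonneg κ _ _ E hE
  refine ⟨ν, ⟨⟨hν0, ?_⟩, ?_⟩, hν⟩
  · rw [norm_eq_of_nonneg _ hν0]
    refine tendsto_nhds_unique (hν Set.univ) ?_
    simp only [cesaroMean_univ]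
    exact tendsto_const_nhds
  · refine ext_of_measurable fun E hE => ?_
    have h1 := tendsto_integral hn hν (isBddMeas_kernel κ hE)
    simp only [← markovOp_apply κ _ hE] at h1
    refine tendsto_nhds_unique h1 ?_
    have h2 : Tendsto (fun n : ℕ => markovOp κ (cesaroMean κ (n + 1) (x n)) E -
        cesaroMean κ (n + 1) (x n) E) U (𝓝 0) := by
      -- Only two probabilities survive the telescoping, so `2/(n+1)` is a crude bound independent
      -- of the starting point, which is therefore free to vary with `n`.
      have h3 : Tendsto (fun n : ℕ => 2 * (1 / ((n : ℝ) + 1))) U (𝓝 0) := by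
        simpa using (tendsto_one_div_add_atTop_nhds_zero_nat.mono_left hU).const_mul (2 : ℝ)
      refine squeeze_zero_norm (fun n => ?_) h3
      rw [← FinAddMeasure.sub_apply, markovOp_cesaroMean_sub, FinAddMeasure.smul_apply,
        FinAddMeasure.sub_apply, ofMeasure_apply _ hE, ofMeasure_apply _ hE, Real.norm_eq_abs,
        abs_mul, mul_comm, abs_of_nonneg (by positivity : 0 ≤ 1 / ((n + 1 : ℕ) : ℝ))]
      push_cast
      refine mul_le_mul_of_nonneg_right ?_ (by positivity)
      have a1 := measureReal_nonneg (μ := (κ ^ (n + 1 + 1)) (x n)) (s := E)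
      have a2 := measureReal_nonneg (μ := (κ ^ 1) (x n)) (s := E)
      have a3 := measureReal_le_one (μ := (κ ^ (n + 1 + 1)) (x n)) (s := E)
      have a4 := measureReal_le_one (μ := (κ ^ 1) (x n)) (s := E)
      rw [abs_le]
      constructor <;> linarith
    simpa using h2.add (hν E)

end

noncomputable section

namespace FinAddMeasure

variable {X : Type*} [MeasurableSpace X]

/-! ### Separating sets for singular families, and passage to genuine measures -/

theorem apply_biInter_eq_univ {μ : FinAddMeasure X} (hμ : 0 ≤ μ) {ι : Type*} (s : Finset ι)
    {D : ι → Set X} (hD : ∀ i ∈ s, MeasurableSet (D i)) (h : ∀ i ∈ s, μ (D i) = μ Set.univ) :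
    μ (⋂ i ∈ s, D i) = μ Set.univ := by
  classical
  induction s using Finset.induction_on with
  | empty => simp
  | insert j s hj ih =>
    have hs : ∀ i ∈ s, MeasurableSet (D i) := fun i hi => hD i (Finset.mem_insert_of_mem hi)
    have hjm : MeasurableSet (D j) := hD j (by simp)
    have ih := ih hs fun i hi => h i (Finset.mem_insert_of_mem hi)
    have hsm : MeasurableSet (⋂ i ∈ s, D i) := Finset.measurableSet_biInter s hs
    rw [Finset.set_biInter_insert]
    have h1 := μ.union' (D j ∩ ⋂ i ∈ s, D i) (D j \ ⋂ i ∈ s, D i) (hjm.inter hsm)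
      (hjm.diff hsm) (Set.disjoint_sdiff_inter.symm)
    rw [Set.inter_union_sdiff, h j (by simp)] at h1
    have h2 : μ (D j \ ⋂ i ∈ s, D i) ≤ μ (⋂ i ∈ s, D i)ᶜ :=
      mono_of_nonneg hμ (hjm.diff hsm) hsm.compl fun x hx => hx.2
    have h3 : 0 ≤ μ (D j \ ⋂ i ∈ s, D i) := hμ _ (hjm.diff hsm)
    rw [apply_compl μ hsm, ih] at h2
    linarith

/-- Intersect, over all `j ≠ i`, the sets on which `H i` has full mass and `H j` none. Finitely many
intersections cost no mass even without countable additivity. -/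
theorem exists_separating_sets {m : ℕ} {H : Fin m → FinAddMeasure X} (hH : ∀ i, 0 ≤ H i)
    (hs : ∀ i j, i ≠ j → (H i).IsSingular (H j)) :
    ∃ D : Fin m → Set X, (∀ i, MeasurableSet (D i)) ∧ (∀ i, H i (D i) = H i Set.univ) ∧
      ∀ i j, i ≠ j → H j (D i) = 0 := by
  classical
  have : ∀ i j, ∃ D : Set X, MeasurableSet D ∧ (i ≠ j → H i D = H i Set.univ ∧ H j D = 0) := by
    intro i j
    by_cases hij : i = j
    · exact ⟨∅, MeasurableSet.empty, fun h => absurd hij h⟩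
    · obtain ⟨D₁, D₂, h1, h2, hd, h3, h4⟩ := hs i j hij
      refine ⟨D₁, h1, fun _ => ⟨h3, le_antisymm ?_ (hH j _ h1)⟩⟩
      have h5 := mono_of_nonneg (hH j) h1 h2.compl (Set.subset_compl_iff_disjoint_right.2 hd)
      rw [apply_compl _ h2, h4, sub_self] at h5
      exact h5
  choose D hDm hD using this
  have hm : ∀ i, MeasurableSet (⋂ j ∈ Finset.univ.erase i, D i j) := fun i =>
    Finset.measurableSet_biInter _ fun j _ => hDm i j
  refine ⟨fun i => ⋂ j ∈ Finset.univ.erase i, D i j, hm, fun i => ?_, fun i j hij => ?_⟩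
  · exact apply_biInter_eq_univ (hH i) _ (fun j _ => hDm i j) fun j hj =>
      (hD i j (Finset.ne_of_mem_erase hj).symm).1
  · refine le_antisymm ?_ (hH j _ (hm i))
    rw [← (hD i j hij).2]
    refine mono_of_nonneg (hH j) (hm i) (hDm i j) fun x hx => ?_
    simp only [Set.mem_iInter] at hx
    exact hx j (by simp [Ne.symm hij])

theorem exists_measure_real_eq {μ : FinAddMeasure X} (hμ : 0 ≤ μ) (hca : μ ∈ caSubspace X) :
    ∃ φ : Measure X, IsFiniteMeasure φ ∧ ∀ E, MeasurableSet E → φ.real E = μ E := by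
  let φ : Measure X := Measure.ofMeasurable (fun E _ => ENNReal.ofReal (μ E))
    (by rw [μ.empty', ENNReal.ofReal_zero]) (fun E hE hd => by
      have hs := hca E hE hd
      rw [← hs.tsum_eq]
      exact ENNReal.ofReal_tsum_of_nonneg (fun i => hμ _ (hE i)) hs.summable)
  have hφ : ∀ E, MeasurableSet E → φ E = ENNReal.ofReal (μ E) := fun E hE =>
    Measure.ofMeasurable_apply E hE
  refine ⟨φ, ⟨by rw [hφ _ MeasurableSet.univ]; exact ENNReal.ofReal_lt_top⟩, fun E hE => ?_⟩
  rw [measureReal_def, hφ E hE, ENNReal.toReal_ofReal (hμ E hE)]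

end FinAddMeasure

open FinAddMeasure

variable {X : Type*} [MeasurableSpace X]

/-! ### Countable additivity of the invariant measures -/

theorem IsStochasticallyClosed.pow_real_eq_one {κ : Kernel X X} [IsMarkovKernel κ] {K : Set X}
    (hK : IsStochasticallyClosed κ K) (n : ℕ) : ∀ x ∈ K, ((κ ^ (n + 1)) x).real K = 1 := by
  induction n with
  | zero =>
    intro x hx
    rw [zero_add, pow_one, measureReal_def, hK.2 x hx, ENNReal.toReal_one]
  | succ n ih =>
    intro x hx
    rw [add_comm, kernel_pow_add_real κ 1 (n + 1) x hK.1, pow_one]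
    have hae : ∀ᵐ y ∂κ x, y ∈ K :=
      (mem_ae_iff_prob_eq_one hK.1).2 (hK.2 x hx)
    rw [integral_congr_ae (hae.mono fun y hy => ih y hy)]
    simp

theorem IsStochasticallyClosed.cesaroMean_eq_one {κ : Kernel X X} [IsMarkovKernel κ] {K : Set X}
    (hK : IsStochasticallyClosed κ K) {x : X} (hx : x ∈ K) (n : ℕ) :
    cesaroMean κ (n + 1) x K = 1 := by
  rw [← cesaroMean_univ κ n x, cesaroMean_apply κ _ x hK.1,
    cesaroMean_apply κ _ x MeasurableSet.univ]
  congr 1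
  refine Finset.sum_congr rfl fun k hk => ?_
  obtain ⟨j, rfl⟩ := Nat.exists_eq_add_of_le' (Finset.mem_Icc.1 hk).1
  rw [hK.pow_real_eq_one j x hx, probReal_univ]

/-- Under the hypotheses there is a countably additive invariant measure that dominates all
invariant finitely additive probabilities. -/
theorem exists_dominating_invariant (κ : Kernel X X) [IsMarkovKernel κ]
    (hfin : ConditionDoubleStar κ) (hα : ConditionAlpha κ) (hβ : ConditionBeta κ) :
    ConditionStar κ ∧ ∃ μ : FinAddMeasure X, 0 ≤ μ ∧ μ ∈ caSubspace X ∧ markovOp κ μ = μ ∧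
      ∀ ν ∈ invariantProb κ, ν ≤ μ := by
  obtain ⟨m, H, hH⟩ := exists_isDisjointBasis κ hfin
  have hH0 : ∀ i, 0 ≤ H i := fun i => (hH.prob i).1
  have hH1 : ∀ i, H i Set.univ = 1 := fun i => by
    rw [← norm_eq_of_nonneg _ (hH0 i)]; exact (hH.prob i).2
  have hinv : ∀ i, markovOp κ (H i) = H i := fun i => by
    have : H i ∈ invariantSpace κ := hH.span_eq ▸ Submodule.subset_span ⟨i, rfl⟩
    exact this
  obtain ⟨D, hDm, hD1, hD0⟩ := exists_separating_sets hH0 (hβ m H hH)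
  -- Since `H i (D j) = δ_ij`, evaluating at `D j` reads off the coefficient of `H j`.
  have hrep : ∀ ν, markovOp κ ν = ν → ν = ∑ j, ν (D j) • H j := by
    intro ν hν
    have hmem : ν ∈ Submodule.span ℝ (Set.range H) := by rw [hH.span_eq]; exact hν
    obtain ⟨c, rfl⟩ := (Submodule.mem_span_range_iff_exists_fun ℝ).1 hmem
    refine Finset.sum_congr rfl fun j _ => ?_
    congr 1
    rw [FinAddMeasure.sum_apply, Finset.sum_eq_single j]
    · rw [FinAddMeasure.smul_apply, hD1, hH1, mul_one]
    · intro i _ hij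
      rw [FinAddMeasure.smul_apply, hD0 j i (Ne.symm hij), mul_zero]
    · simp
  have hsum : ∀ ν ∈ invariantProb κ, ∑ j, ν (D j) = 1 := by
    rintro ν ⟨⟨hν0, hν1⟩, hν⟩
    have h1 := congrArg (fun ρ : FinAddMeasure X => ρ Set.univ) (hrep ν hν)
    rw [norm_eq_of_nonneg _ hν0] at hν1
    simp only [FinAddMeasure.sum_apply, FinAddMeasure.smul_apply, hH1, mul_one, hν1] at h1
    exact h1.symm
  have hca : ∀ i, H i ∈ caSubspace X := by
    intro i
    obtain ⟨K, hKD, hK1, hK⟩ := hα (H i) ⟨hH.prob i, hinv i⟩ (D i) (hDm i)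
      ((hD1 i).trans (hH1 i))
    obtain ⟨x, hx⟩ : K.Nonempty := by
      by_contra hne
      rw [Set.not_nonempty_iff_eq_empty] at hne
      rw [hne, (H i).empty'] at hK1
      exact zero_ne_one hK1
    refine mem_caSubspace_of_setwise_tendsto (σ := fun n => cesaroMean κ (n + 1) x)
      (fun n => cesaroMean_nonneg κ _ x) (fun n => cesaroMean_mem_caSubspace κ _ x)
      fun E hE => ?_
    -- It is enough to identify the limit along every ultrafilter; each is an invariant probability,
    -- so it is determined by its values on the sets `D j`.
    rw [tendsto_iff_ultrafilter]
    intro U hU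
    obtain ⟨ν, hν, hlim⟩ := exists_invariantProb_tendsto κ (fun _ => x) U hU
    have hνK : ν K = 1 := by
      refine tendsto_nhds_unique (hlim K) ?_
      simp only [hK.cesaroMean_eq_one hx]
      exact tendsto_const_nhds
    have hν0 : 0 ≤ ν := hν.1.1
    -- The coefficients are nonnegative with sum `1`, so full mass on `D i` forces all the others to
    -- vanish and the limit to be `H i`.
    have hνi : 1 ≤ ν (D i) := hνK ▸ mono_of_nonneg hν0 hK.1 (hDm i) hKD
    have hs := hsum ν hν
    rw [← Finset.add_sum_erase _ _ (Finset.mem_univ i)] at hs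
    have hnn : ∀ j ∈ Finset.univ.erase i, 0 ≤ ν (D j) := fun j _ => hν0 _ (hDm j)
    have hz := (Finset.sum_eq_zero_iff_of_nonneg hnn).1
      (le_antisymm (by linarith) (Finset.sum_nonneg hnn))
    have hνH : ν = H i := by
      rw [hrep ν hν.2, ← Finset.add_sum_erase _ _ (Finset.mem_univ i),
        Finset.sum_eq_zero fun j hj => by rw [hz j hj, zero_smul], add_zero]
      rw [Finset.sum_eq_zero hz, add_zero] at hs
      rw [hs, one_smul]
    rw [← hνH]
    exact hlim E
  refine ⟨fun ν hν => ?_, ∑ i, H i, Finset.sum_nonneg fun i _ => hH0 i,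
    Submodule.sum_mem _ fun i _ => hca i, ?_, fun ν hν => ?_⟩
  · rw [hrep ν hν.2]
    exact Submodule.sum_mem _ fun i _ => Submodule.smul_mem _ _ (hca i)
  · rw [map_sum]
    exact Finset.sum_congr rfl fun i _ => hinv i
  · rw [hrep ν hν.2]
    refine Finset.sum_le_sum fun i _ => ?_
    -- Coefficients lie in `[0, 1]`, so `∑ H i`, with all coefficients `1`, dominates.
    have hle : ν (D i) ≤ 1 := by
      rw [← hsum ν hν]
      exact Finset.single_le_sum (f := fun j => ν (D j)) (fun j _ => hν.1.1 _ (hDm j))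
        (Finset.mem_univ i)
    have := smul_nonneg (sub_nonneg.2 hle) (hH0 i)
    rwa [sub_smul, one_smul, sub_nonneg] at this

/-- A finite measure that is invariant and dominates the invariant finitely additive
probabilities. -/
structure IsDominatingInvariant (κ : Kernel X X) [IsMarkovKernel κ] (φ : Measure X) : Prop where
  finite : IsFiniteMeasure φ
  invariant : φ.bind κ = φ
  dominates : ∀ ν ∈ invariantProb κ, ∀ E, MeasurableSet E → ν E ≤ φ.real E

theorem exists_isDominatingInvariant (κ : Kernel X X) [IsMarkovKernel κ]
    (hfin : ConditionDoubleStar κ) (hα : ConditionAlpha κ) (hβ : ConditionBeta κ) :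
    ∃ φ : Measure X, IsDominatingInvariant κ φ := by
  obtain ⟨-, μ, hμ0, hμ, hinv, hdom⟩ := exists_dominating_invariant κ hfin hα hβ
  obtain ⟨φ, hφ, hφμ⟩ := exists_measure_real_eq hμ0 hμ
  have hμφ : ofMeasure φ = μ := ext_of_measurable fun E hE => by
    rw [ofMeasure_apply φ hE, hφμ E hE]
  have hfb : IsFiniteMeasure (φ.bind κ) :=
    ⟨by rw [Measure.bind_apply MeasurableSet.univ κ.aemeasurable]; simp⟩
  refine ⟨φ, hφ, ?_, fun ν hν E hE => (hdom ν hν E hE).trans (hφμ E hE).ge⟩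
  ext E hE
  rw [← measureReal_eq_measureReal_iff, ← integral_kernel_real κ φ hE,
    ← integral_ofMeasure φ (isBddMeas_kernel κ hE), hμφ, ← markovOp_apply κ μ hE, hinv, hφμ E hE]

end

noncomputable section

open FinAddMeasure

variable {X : Type*} [MeasurableSpace X]

/-! ### Doeblin's condition -/

theorem integrable_of_isBddMeas {f : X → ℝ} (hf : IsBddMeas f) (m : Measure X)
    [IsFiniteMeasure m] : Integrable f m := by
  obtain ⟨hfm, C, hC⟩ := hf
  exact Integrable.of_bound hfm.aestronglyMeasurable C (ae_of_all _ fun x => by simpa using hC x)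

/-- Since `f ≤ 1`, pointwise `f ≤ c + 1_{f > c}`. This splits the space into a part where `f` is
small and a part of small mass. -/
theorem integral_le_add_measureReal_lt (m : Measure X) [IsProbabilityMeasure m] {f : X → ℝ}
    (hf : IsBddMeas f) (h1 : ∀ x, f x ≤ 1) {c : ℝ} (hc : 0 ≤ c) :
    ∫ x, f x ∂m ≤ c + m.real {x | c < f x} := by
  have hS : MeasurableSet {x | c < f x} := measurableSet_lt measurable_const hf.1
  have h2 : ∫ x, f x ∂m ≤ ∫ x, (c + {x | c < f x}.indicator (fun _ => (1 : ℝ)) x) ∂m := by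
    refine integral_mono (integrable_of_isBddMeas hf m)
      ((integrable_const c).add ((integrable_const 1).indicator hS)) fun x => ?_
    by_cases hx : c < f x
    · simp only [Set.indicator, Set.mem_ofPred_eq, hx, if_true]
      linarith [h1 x]
    · simp only [Set.indicator, Set.mem_ofPred_eq, hx, if_false]
      linarith
  rwa [integral_add (integrable_const c) ((integrable_const 1).indicator hS),
    integral_indicator_const _ hS, integral_const, probReal_univ, one_smul, smul_eq_mul,
    mul_one] at h2

namespace IsDominatingInvariant

variable {κ : Kernel X X} [IsMarkovKernel κ] {φ : Measure X}

theorem bind_pow (h : IsDominatingInvariant κ φ) (n : ℕ) : φ.bind (κ ^ n) = φ := by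
  induction n with
  | zero => rw [pow_zero]; exact Measure.bind_dirac
  | succ n ih => rw [Kernel.pow_add, ← Measure.comp_assoc, pow_one, h.invariant, ih]

/-- Otherwise choose, for each `n`, a violating set `E n` and point `x n`. An ultrafilter limit of
the means at the `x n` is an invariant probability with mass at least `τ` on `⋃ n, E n`, against the
domination by `φ`. -/
theorem exists_cesaroMean_le (h : IsDominatingInvariant κ φ) {τ : ℝ} (hτ : 0 < τ) :
    ∃ (n : ℕ) (δ : ℝ), 0 < δ ∧ ∀ E, MeasurableSet E → φ.real E ≤ δ →
      ∀ x, cesaroMean κ (n + 1) x E ≤ τ := by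
  have := h.finite
  by_contra! hcon
  -- These thresholds sum to `τ / 2`, strictly below the mass `τ` that the limit gives to the union.
  have hδ : ∀ n : ℕ, 0 < τ / 4 * (1 / 2) ^ n := fun n => by positivity
  choose E hE hφE x hx using fun n : ℕ => hcon n _ (hδ n)
  obtain ⟨ν, hν, hlim⟩ := exists_invariantProb_tendsto κ x (hyperfilter ℕ)
    Nat.hyperfilter_le_atTop
  have hm : MeasurableSet (⋃ n, E n) := MeasurableSet.iUnion hE
  have h1 : τ ≤ ν (⋃ n, E n) := ge_of_tendsto' (hlim _) fun n => (hx n).le.trans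
    (mono_of_nonneg (cesaroMean_nonneg κ _ _) (hE n) hm (Set.subset_iUnion E n))
  have hs : HasSum (fun n : ℕ => τ / 4 * (1 / 2) ^ n) (τ / 2) := by
    have := hasSum_geometric_two.mul_left (τ / 4)
    rwa [show τ / 4 * 2 = τ / 2 by ring] at this
  have h2 : φ.real (⋃ n, E n) ≤ τ / 2 := by
    rw [measureReal_def]
    refine ENNReal.toReal_le_of_le_ofReal (by positivity) ((measure_iUnion_le E).trans ?_)
    rw [← hs.tsum_eq, ENNReal.ofReal_tsum_of_nonneg (fun n => (hδ n).le) hs.summable]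
    refine ENNReal.tsum_le_tsum fun n => ?_
    rw [← ofReal_measureReal]
    exact ENNReal.ofReal_le_ofReal (hφE n)
  linarith [h.dominates ν hν _ hm]

/-- If `p^(n+1)(x, E) > τ`, then at each time `i = 1, …, n + 1` the chain must have probability at
least `τ/2` of being where `E` is still reached in the remaining steps with probability above `τ/2`.
The union `F` of those places is `φ`-small by invariance, so the Cesàro mean of `F` cannot be that
large. -/
theorem exists_pow_le (h : IsDominatingInvariant κ φ) {τ : ℝ} (hτ : 0 < τ) :
    ∃ (k : ℕ) (δ : ℝ), 1 ≤ k ∧ 0 < δ ∧ ∀ E, MeasurableSet E → φ.real E ≤ δ →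
      ∀ x, ((κ ^ k) x).real E ≤ τ := by
  have := h.finite
  obtain ⟨n, δ, hδ, hn⟩ := h.exists_cesaroMean_le (show 0 < τ / 4 by linarith)
  -- Markov's inequality at level `τ/2` multiplies `φ(E)` by at most `2/τ`, and there are `n + 1`
  -- sets `S j`; this threshold makes `φ(F) ≤ δ`.
  refine ⟨n + 1, δ * τ / (2 * (n + 1)), by omega, by positivity, fun E hE hφE x => ?_⟩
  by_contra! hlt
  set S : ℕ → Set X := fun j => {y | τ / 2 < ((κ ^ j) y).real E} with hS
  have hSm : ∀ j, MeasurableSet (S j) := fun j =>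
    measurableSet_lt measurable_const (isBddMeas_kernel (κ ^ j) hE).1
  set F := ⋃ j ∈ Finset.range (n + 1), S j with hF
  have hFm : MeasurableSet F := Finset.measurableSet_biUnion _ fun j _ => hSm j
  have hSφ : ∀ j, φ.real (S j) ≤ 2 / τ * φ.real E := by
    intro j
    have h1 := mul_meas_ge_le_integral_of_nonneg (μ := φ)
      (ae_of_all _ fun y => measureReal_nonneg (μ := (κ ^ j) y) (s := E))
      (integrable_of_isBddMeas (isBddMeas_kernel (κ ^ j) hE) φ) (τ / 2)
    rw [integral_kernel_real _ _ hE, h.bind_pow] at h1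
    have h2 : φ.real (S j) ≤ φ.real {y | τ / 2 ≤ ((κ ^ j) y).real E} :=
      measureReal_mono fun y (hy : τ / 2 < _) => hy.le
    have h3 := (mul_le_mul_of_nonneg_left h2 (half_pos hτ).le).trans h1
    rw [div_mul_eq_mul_div, le_div_iff₀ hτ]
    linarith
  have hφF : φ.real F ≤ δ := by
    calc φ.real F ≤ ∑ j ∈ Finset.range (n + 1), φ.real (S j) := measureReal_biUnion_finset_le _ _
      _ ≤ ∑ j ∈ Finset.range (n + 1), 2 / τ * (δ * τ / (2 * (n + 1))) :=
          Finset.sum_le_sum fun j _ => (hSφ j).trans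
            (mul_le_mul_of_nonneg_left hφE (by positivity))
      _ = δ := by
          rw [Finset.sum_const, Finset.card_range, nsmul_eq_mul]
          push_cast
          field_simp
  have hi : ∀ i ∈ Finset.Icc 1 (n + 1), τ / 2 ≤ ((κ ^ i) x).real F := by
    intro i hi
    obtain ⟨hi1, hi2⟩ := Finset.mem_Icc.1 hi
    have h1 := kernel_pow_add_real κ i (n + 1 - i) x hE
    rw [Nat.add_sub_cancel' hi2] at h1
    have h2 := integral_le_add_measureReal_lt ((κ ^ i) x)
      (isBddMeas_kernel (κ ^ (n + 1 - i)) hE) (fun _ => measureReal_le_one) (half_pos hτ).le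
    have h3 : ((κ ^ i) x).real (S (n + 1 - i)) ≤ ((κ ^ i) x).real F :=
      measureReal_mono (Set.subset_biUnion_of_mem (u := S)
        (show n + 1 - i ∈ (Finset.range (n + 1) : Set ℕ) by
          simp only [Finset.coe_range, Set.mem_Iio]; omega)) (measure_ne_top _ _)
    linarith
  have h1 := hn F hFm hφF x
  rw [cesaroMean_apply κ _ x hFm] at h1
  have h2 : ((n : ℝ) + 1) * (τ / 2) ≤ ∑ i ∈ Finset.Icc 1 (n + 1), ((κ ^ i) x).real F := by
    have := Finset.sum_le_sum hi
    simpa using this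
  have h3 : 1 / ((n + 1 : ℕ) : ℝ) * (((n : ℝ) + 1) * (τ / 2)) = τ / 2 := by
    push_cast
    field_simp
  have h4 := mul_le_mul_of_nonneg_left h2 (by positivity : 0 ≤ 1 / ((n + 1 : ℕ) : ℝ))
  linarith

theorem conditionDTilde (h : IsDominatingInvariant κ φ) : ConditionDTilde κ := by
  obtain ⟨n, δ, hδ, hn⟩ := h.exists_cesaroMean_le (show (0 : ℝ) < 1 / 2 by norm_num)
  -- The one `ε` must lie below the threshold for `φ(E)` and also satisfy `1/2 ≤ 1 - ε`.
  refine ⟨φ, min δ (1 / 2), n + 1, h.finite, by positivity, by omega, fun E hE hφE x => ?_⟩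
  have h1 := hn E hE (hφE.le.trans (min_le_left _ _)) x
  rw [cesaroMean_apply κ _ x hE] at h1
  linarith [min_le_right δ (1 / 2)]

theorem conditionD (h : IsDominatingInvariant κ φ) : ConditionD κ := by
  obtain ⟨k, δ, hk, hδ, hle⟩ := h.exists_pow_le (show (0 : ℝ) < 1 / 2 by norm_num)
  refine ⟨φ, min δ (1 / 2), k, h.finite, by positivity, hk, fun E hE hφE x => ?_⟩
  linarith [hle E hE (hφE.trans (min_le_left _ _)) x, min_le_right δ (1 / 2)]

end IsDominatingInvariant

end

noncomputable section

open FinAddMeasure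

variable {X : Type*} [MeasurableSpace X]

/-! ### Approximation by functions that are step functions in the first variable -/

/-- Measurable functions on `X × X` that depend on the first variable only through the atoms of a
finite measurable partition. -/
def IsStepInFst (ψ : X × X → ℝ) : Prop :=
  Measurable ψ ∧ ∃ c : SimpleFunc X ℕ, ∀ y y' z, c y = c y' → ψ (y, z) = ψ (y', z)

theorem IsStepInFst.add {ψ ψ' : X × X → ℝ} (h : IsStepInFst ψ) (h' : IsStepInFst ψ') :
    IsStepInFst (ψ + ψ') := by
  obtain ⟨hm, c, hc⟩ := h
  obtain ⟨hm', c', hc'⟩ := h'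
  -- Pairing the labels encodes the common refinement of the two finite partitions.
  refine ⟨hm.add hm', (c.pair c').map (fun p => Nat.pair p.1 p.2), fun y y' z hy => ?_⟩
  simp only [SimpleFunc.map_apply, SimpleFunc.pair_apply, Nat.pair_eq_pair] at hy
  simp only [Pi.add_apply, hc y y' z hy.1, hc' y y' z hy.2]

variable (X) in
/-- The measurable sets of `X × X` whose sections depend only on the atoms of a finite measurable
partition of the first factor. -/
def stepSets : Set (Set (X × X)) :=
  {S | MeasurableSet S ∧
    ∃ c : SimpleFunc X ℕ, ∀ y y' z, c y = c y' → ((y, z) ∈ S ↔ (y', z) ∈ S)}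

theorem isSetAlgebra_stepSets : IsSetAlgebra (stepSets X) where
  empty_mem := ⟨MeasurableSet.empty, SimpleFunc.const X 0, fun y y' z _ => by simp⟩
  compl_mem := by
    rintro S ⟨hS, c, hc⟩
    exact ⟨hS.compl, c, fun y y' z h => not_congr (hc y y' z h)⟩
  union_mem := by
    rintro S T ⟨hS, c, hc⟩ ⟨hT, c', hc'⟩
    refine ⟨hS.union hT, (c.pair c').map (fun p => Nat.pair p.1 p.2), fun y y' z hy => ?_⟩
    simp only [SimpleFunc.map_apply, SimpleFunc.pair_apply, Nat.pair_eq_pair] at hy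
    exact or_congr (hc y y' z hy.1) (hc' y y' z hy.2)

/-- A measurable rectangle is a step set, its partition being the base and its complement. -/
theorem generateFrom_stepSets :
    (Prod.instMeasurableSpace : MeasurableSpace (X × X)) =
      MeasurableSpace.generateFrom (stepSets X) := by
  refine le_antisymm ?_ (MeasurableSpace.generateFrom_le fun S hS => hS.1)
  rw [← generateFrom_prod]
  refine MeasurableSpace.generateFrom_mono ?_
  rintro _ ⟨s, hs, t, ht, rfl⟩
  have hs : MeasurableSet s := hs
  have ht : MeasurableSet t := ht
  refine ⟨hs.prod ht, SimpleFunc.piecewise s hs (SimpleFunc.const X 1) (SimpleFunc.const X 0),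
    fun y y' z hy => ?_⟩
  by_cases h1 : y ∈ s <;> by_cases h2 : y' ∈ s <;> simp [h1, h2] at hy ⊢

/-- The step sets form an algebra generating the product `σ`-algebra, hence are dense in measure for
a finite `ρ`; indicators and then sums follow. No countable generation of the `σ`-algebra of `X` is
needed. -/
theorem exists_isStepInFst_eLpNorm_le (ρ : Measure (X × X)) [IsFiniteMeasure ρ] {f : X × X → ℝ}
    (hf : MemLp f 1 ρ) {ε : ENNReal} (hε : ε ≠ 0) :
    ∃ ψ : X × X → ℝ, eLpNorm (f - ψ) 1 ρ ≤ ε ∧ IsStepInFst ψ := by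
  refine hf.induction_dense (by simp) IsStepInFst ?_ (fun _ _ h h' => h.add h')
    (fun _ h => h.1.aestronglyMeasurable) hε
  intro a s hs _ ε hε
  have hd := Measure.MeasureDense.of_generateFrom_isSetAlgebra_finite ρ
    (isSetAlgebra_stepSets (X := X)) generateFrom_stepSets
  -- The tolerance may be infinite, so it is capped at `1` before becoming a real number.
  set e := (min ε 1).toReal with he
  have hmin : min ε 1 ≠ ⊤ := ne_top_of_le_ne_top ENNReal.one_ne_top (min_le_right _ _)
  have he0 : 0 < e := ENNReal.toReal_pos (by simp [hε]) hmin
  obtain ⟨t, ⟨ht, c, hc⟩, hst⟩ := hd.approx s hs (measure_ne_top _ _) (e / (|a| + 1))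
    (by positivity)
  refine ⟨t.indicator fun _ => a, ?_, (measurable_const.indicator ht), c, fun y y' z hy => ?_⟩
  · rw [eLpNorm_indicator_sub_indicator, symmDiff_comm]
    refine (eLpNorm_indicator_const_le _ _).trans ?_
    rw [ENNReal.toReal_one, div_one, ENNReal.rpow_one]
    calc ‖a‖ₑ * ρ (symmDiff s t) ≤ ENNReal.ofReal |a| * ENNReal.ofReal (e / (|a| + 1)) := by
          rw [Real.enorm_eq_ofReal_abs]
          exact mul_le_mul_right hst.le _
      _ = ENNReal.ofReal (|a| * (e / (|a| + 1))) := (ENNReal.ofReal_mul (abs_nonneg a)).symm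
      _ ≤ ENNReal.ofReal e := by
          refine ENNReal.ofReal_le_ofReal ?_
          rw [mul_div_assoc', div_le_iff₀ (by positivity)]
          nlinarith [abs_nonneg a]
      _ = min ε 1 := ENNReal.ofReal_toReal hmin
      _ ≤ ε := min_le_left _ _
  · have := hc y y' z hy
    by_cases h1 : (y, z) ∈ t
    · rw [Set.indicator_of_mem h1, Set.indicator_of_mem (this.1 h1)]
    · rw [Set.indicator_of_notMem h1, Set.indicator_of_notMem fun h => h1 (this.2 h)]

/-- The singular part lives on a `φ × φ`-null set. Almost every section of that set is `φ`-null, so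
by hypothesis `η` gives it mass at most `τ`; integrate over `φ`. -/
theorem compProd_singularPart_real_le {φ : Measure X} [IsFiniteMeasure φ] {η : Kernel X X}
    [IsMarkovKernel η] {τ : ℝ} (hτ : 0 ≤ τ)
    (hη : ∀ E, MeasurableSet E → φ E = 0 → ∀ x, (η x).real E ≤ τ) :
    ((φ ⊗ₘ η).singularPart (φ.prod φ)).real Set.univ ≤ τ * φ.real Set.univ := by
  obtain ⟨N, hN, hN1, hN2⟩ := Measure.mutuallySingular_singularPart (φ ⊗ₘ η) (φ.prod φ)
  have h1 : (φ ⊗ₘ η).singularPart (φ.prod φ) Set.univ ≤ (φ ⊗ₘ η) Nᶜ := by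
    rw [← measure_add_measure_compl hN, hN1, zero_add]
    exact Measure.singularPart_le _ _ _
  have h2 : (φ ⊗ₘ η) Nᶜ ≤ ENNReal.ofReal τ * φ Set.univ := by
    rw [Measure.compProd_apply hN.compl, ← lintegral_const]
    refine lintegral_mono_ae ?_
    filter_upwards [Measure.measure_ae_null_of_prod_null hN2] with y hy
    rw [← ofReal_measureReal]
    exact ENNReal.ofReal_le_ofReal (hη _ (measurable_prodMk_left hN.compl) hy y)
  have h3 := h1.trans h2
  rw [measureReal_def, measureReal_def, ← ENNReal.toReal_ofReal hτ, ← ENNReal.toReal_mul]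
  exact ENNReal.toReal_mono (ENNReal.mul_ne_top ENNReal.ofReal_ne_top (measure_ne_top _ _)) h3

/-- The partition is chosen before `E`: it comes from a step approximation `ψ` of the density of `φ
⊗ₘ η` with respect to `φ × φ`, and `u` is the integral of `ψ (y, ·)` over `E`. -/
theorem exists_step_approx {φ : Measure X} [IsFiniteMeasure φ] {η : Kernel X X}
    [IsMarkovKernel η] {τ : ℝ} (hτ : 0 ≤ τ)
    (hη : ∀ E, MeasurableSet E → φ E = 0 → ∀ x, (η x).real E ≤ τ) {ε : ℝ} (hε : 0 < ε) :
    ∃ c : SimpleFunc X ℕ, ∀ E, MeasurableSet E → ∃ u : X → ℝ, Integrable u φ ∧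
      (∀ y y', c y = c y' → u y = u y') ∧
      ∫ y, |(η y).real E - u y| ∂φ ≤ τ * φ.real Set.univ + 2 * ε := by
  set m := φ ⊗ₘ η with hm
  set ρ := φ.prod φ with hρ
  set h : X × X → ℝ := fun p => (m.rnDeriv ρ p).toReal with hh
  have hint : Integrable h ρ := Measure.integrable_toReal_rnDeriv
  obtain ⟨ψ, hψ, hψm, c, hc⟩ := exists_isStepInFst_eLpNorm_le ρ (memLp_one_iff_integrable.2 hint)
    (ENNReal.ofReal_pos.2 hε).ne'
  have hdiff : Integrable (h - ψ) ρ := memLp_one_iff_integrable.1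
    ⟨hint.aestronglyMeasurable.sub hψm.aestronglyMeasurable,
      hψ.trans_lt ENNReal.ofReal_lt_top⟩
  have hψint : Integrable ψ ρ := by simpa using hint.sub hdiff
  have hnorm : ∫ p, |(h - ψ) p| ∂ρ ≤ ε := by
    rw [eLpNorm_one_eq_lintegral_enorm] at hψ
    have h1 := integral_norm_eq_lintegral_enorm hdiff.aestronglyMeasurable
    simp only [Real.norm_eq_abs] at h1
    rw [h1]
    exact ENNReal.toReal_le_of_le_ofReal hε.le hψ
  refine ⟨c, fun E hE => ?_⟩
  set u : X → ℝ := fun y => ∫ z in E, ψ (y, z) ∂φ with hu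
  have huint : Integrable u φ := by
    have h1 : Integrable ψ (φ.prod (φ.restrict E)) := by
      have := hψint.integrableOn (s := Set.univ ×ˢ E)
      rwa [IntegrableOn, hρ, ← Measure.prod_restrict, Measure.restrict_univ] at this
    exact h1.integral_prod_left
  refine ⟨u, huint, fun y y' hy => integral_congr_ae (ae_of_all _ fun z => hc y y' z hy), ?_⟩
  have hfint : Integrable (fun y => (η y).real E) φ :=
    integrable_of_isBddMeas (isBddMeas_kernel η hE) φ
  have hkey : ∀ D, MeasurableSet D → ∫ y in D, ((η y).real E - u y) ∂φ =
      (m.singularPart ρ).real (D ×ˢ E) + ∫ p in D ×ˢ E, (h - ψ) p ∂ρ := by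
    intro D hD
    have h1 : ∫ y in D, (η y).real E ∂φ = m.real (D ×ˢ E) := by
      rw [measureReal_def, hm, Measure.compProd_apply_prod hD hE]
      exact integral_toReal (η.measurable_coe hE).aemeasurable
        (ae_of_all _ fun x => measure_lt_top _ _)
    have h2 : m.real (D ×ˢ E) = (m.singularPart ρ).real (D ×ˢ E) + ∫ p in D ×ˢ E, h p ∂ρ := by
      rw [hh, Measure.setIntegral_toReal_rnDeriv_eq_withDensity' (hD.prod hE)]
      conv_lhs => rw [Measure.haveLebesgueDecomposition_add m ρ]
      rw [measureReal_add_apply]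
    have h3 : ∫ p in D ×ˢ E, ψ p ∂ρ = ∫ y in D, u y ∂φ := setIntegral_prod ψ hψint.integrableOn
    rw [integral_sub hfint.integrableOn huint.integrableOn, h1, h2, ← h3]
    simp only [Pi.sub_apply]
    rw [integral_sub hint.integrableOn hψint.integrableOn]
    ring
  have hbd : ∀ S : Set (X × X), |∫ p in S, (h - ψ) p ∂ρ| ≤ ε := fun S =>
    (abs_integral_le_integral_abs).trans
      ((setIntegral_le_integral hdiff.abs (ae_of_all _ fun _ => abs_nonneg _)).trans hnorm)
  have hg := hfint.sub huint
  have hgm : Measurable fun y => (η y).real E - u y := by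
    refine (isBddMeas_kernel η hE).1.sub ?_
    exact (hψm.stronglyMeasurable.integral_prod_right' (ν := φ.restrict E)).measurable
  -- Split according to the sign of the difference. The positive half costs the singular mass plus
  -- `ε`, while the negative half costs only `ε`, since the singular part is nonnegative.
  have h5 := integral_norm_eq_pos_sub_neg hg
  simp only [Real.norm_eq_abs, Pi.sub_apply] at h5
  rw [h5, hkey _ (measurableSet_le measurable_const hgm),
    hkey _ (measurableSet_le hgm measurable_const)]
  have h6 : ∀ S : Set (X × X), (m.singularPart ρ).real S ≤ τ * φ.real Set.univ := fun S =>
    (measureReal_mono (Set.subset_univ S)).trans (compProd_singularPart_real_le hτ hη)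
  have h7 := fun S => abs_le.1 (hbd S)
  have h8 := h6 ({y | 0 ≤ (η y).real E - u y} ×ˢ E)
  have h9 := (h7 ({y | 0 ≤ (η y).real E - u y} ×ˢ E)).2
  have h10 := (h7 ({y | (η y).real E - u y ≤ 0} ×ˢ E)).1
  have h11 := measureReal_nonneg (μ := m.singularPart ρ)
    (s := {y | (η y).real E - u y ≤ 0} ×ˢ E)
  linarith

/-! ### Averages over the atoms of a partition -/

/-- The average of `f` over the atom `{c = j}`. -/
def fiberAverage (φ : Measure X) (c : SimpleFunc X ℕ) (f : X → ℝ) (j : ℕ) : ℝ :=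
  (φ.real (c ⁻¹' {j}))⁻¹ * ∫ y in c ⁻¹' {j}, f y ∂φ

/-- The function `u` is constant on the atom, and the average is no further from that constant, in
`L¹` of the atom, than `f` is; the triangle inequality gives the factor `2`. Averages, unlike `u`,
are values of measures in `E` and stay in `[0, 1]`. -/
theorem setIntegral_abs_sub_fiberAverage_le (φ : Measure X) [IsFiniteMeasure φ]
    (c : SimpleFunc X ℕ) {f u : X → ℝ} (hf : Integrable f φ)
    (hc : ∀ y y', c y = c y' → u y = u y') (j : ℕ) :
    ∫ y in c ⁻¹' {j}, |f y - fiberAverage φ c f (c y)| ∂φ ≤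
      2 * ∫ y in c ⁻¹' {j}, |f y - u y| ∂φ := by
  set B := c ⁻¹' {j} with hB
  have hBm : MeasurableSet B := c.measurableSet_fiber j
  rcases B.eq_empty_or_nonempty with h0 | ⟨y₀, hy₀⟩
  · simp [h0]
  have hy₀ : c y₀ = j := hy₀
  set a := fiberAverage φ c f j with ha
  have hua : ∀ y ∈ B, u y = u y₀ := fun y (hy : c y = j) => hc y y₀ (hy.trans hy₀.symm)
  have h1 : ∫ y in B, |f y - fiberAverage φ c f (c y)| ∂φ = ∫ y in B, |f y - a| ∂φ :=
    setIntegral_congr_fun hBm fun y (hy : c y = j) => by simp only [hy, ha]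
  have h2 : ∫ y in B, |f y - u y| ∂φ = ∫ y in B, |f y - u y₀| ∂φ :=
    setIntegral_congr_fun hBm fun y hy => by simp only [hua y hy]
  rw [h1, h2]
  have hfi : ∀ b : ℝ, Integrable (fun y => f y - b) (φ.restrict B) := fun b =>
    hf.integrableOn.sub (integrable_const b)
  have h3 : ∫ y in B, |f y - a| ∂φ ≤ ∫ y in B, (|f y - u y₀| + |u y₀ - a|) ∂φ :=
    integral_mono (hfi a).abs ((hfi _).abs.add (integrable_const _)) fun y => abs_sub_le _ _ _
  -- On a `φ`-null atom the average has the default value `0`, and the claim is trivial there.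
  have h5 : φ.real B * |u y₀ - a| ≤ ∫ y in B, |f y - u y₀| ∂φ := by
    by_cases hφ : φ.real B = 0
    · rw [hφ, zero_mul]
      exact integral_nonneg fun y => abs_nonneg _
    · have h6 : φ.real B * (a - u y₀) = ∫ y in B, (f y - u y₀) ∂φ := by
        rw [integral_sub hf.integrableOn (integrable_const _), integral_const,
          measureReal_restrict_apply_univ, smul_eq_mul, mul_sub, ha, fiberAverage, ← hB,
          ← mul_assoc, mul_inv_cancel₀ hφ, one_mul]
      rw [abs_sub_comm, ← abs_of_nonneg (measureReal_nonneg (μ := φ) (s := B)), ← abs_mul, h6]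
      exact abs_integral_le_integral_abs
  rw [integral_add (hfi _).abs (integrable_const _), integral_const,
    measureReal_restrict_apply_univ, smul_eq_mul] at h3
  linarith

theorem fiberAverage_mem_Icc (φ : Measure X) [IsFiniteMeasure φ] (c : SimpleFunc X ℕ)
    {f : X → ℝ} (h0 : ∀ y, 0 ≤ f y) (h1 : ∀ y, f y ≤ 1) (hf : Integrable f φ) (j : ℕ) :
    fiberAverage φ c f j ∈ Set.Icc (0 : ℝ) 1 := by
  set B := c ⁻¹' {j} with hB
  refine ⟨mul_nonneg (inv_nonneg.2 measureReal_nonneg) (integral_nonneg h0), ?_⟩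
  have h2 : ∫ y in B, f y ∂φ ≤ φ.real B := by
    have := integral_mono hf.integrableOn (integrable_const (μ := φ.restrict B) (1 : ℝ)) h1
    simpa using this
  exact (mul_le_mul_of_nonneg_left h2 (inv_nonneg.2 measureReal_nonneg)).trans
    inv_mul_le_one

theorem measurable_comp_simpleFunc (c : SimpleFunc X ℕ) (g : ℕ → ℝ) :
    Measurable fun y => g (c y) :=
  (measurable_from_nat (f := g)).comp c.measurable

theorem integral_eq_sum_setIntegral_fiber (c : SimpleFunc X ℕ) {m : Measure X} {f : X → ℝ}
    (hf : Integrable f m) : ∫ y, f y ∂m = ∑ j ∈ c.range, ∫ y in c ⁻¹' {j}, f y ∂m := by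
  have hcover : ⋃ j ∈ c.range, c ⁻¹' {j} = Set.univ := by
    ext y
    simp
  rw [← setIntegral_univ, ← hcover]
  exact integral_biUnion_finset _ (fun j _ => c.measurableSet_fiber j)
    (fun i _ j _ hij => Disjoint.preimage _ (by simpa using hij)) (fun j _ => hf.integrableOn)

theorem integral_abs_sub_fiberAverage_le (φ : Measure X) [IsFiniteMeasure φ]
    (c : SimpleFunc X ℕ) {f u : X → ℝ} (hf : Integrable f φ)
    (hu : Integrable u φ) (hc : ∀ y y', c y = c y' → u y = u y') :
    ∫ y, |f y - fiberAverage φ c f (c y)| ∂φ ≤ 2 * ∫ y, |f y - u y| ∂φ := by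
  have hav : Integrable (fun y => fiberAverage φ c f (c y)) φ := by
    have := (c.map (fiberAverage φ c f)).integrable_of_isFiniteMeasure (μ := φ)
    exact this
  rw [integral_eq_sum_setIntegral_fiber c (f := fun y => |f y - fiberAverage φ c f (c y)|)
      (hf.sub hav).abs,
    integral_eq_sum_setIntegral_fiber c (f := fun y => |f y - u y|) (hf.sub hu).abs, Finset.mul_sum]
  exact Finset.sum_le_sum fun j _ => setIntegral_abs_sub_fiberAverage_le φ c hf hc j

end

noncomputable section

open FinAddMeasure

variable {X : Type*} [MeasurableSpace X]

/-! ### Quasicompactness -/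

theorem IsBddMeas.integral_kernel (η : Kernel X X) [IsMarkovKernel η] {f : X → ℝ}
    (hf : IsBddMeas f) : IsBddMeas fun x => ∫ y, f y ∂η x := by
  obtain ⟨hfm, C, hC⟩ := hf
  refine ⟨(hfm.stronglyMeasurable.integral_kernel (κ := η)).measurable, C, fun x => ?_⟩
  have := norm_integral_le_of_norm_le_const (μ := η x) (f := f) (C := C) (ae_of_all _ hC)
  simpa using this

/-- Duality between the operator on measures and the one on functions: for simple functions it is
the definition with finite sums exchanged, and uniform approximation does the rest. It replaces
Fubini for finitely additive `ν`. -/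
theorem integral_markovOp (η : Kernel X X) [IsMarkovKernel η] (ν : FinAddMeasure X) {f : X → ℝ}
    (hf : IsBddMeas f) :
    (markovOp η ν).integral f = ν.integral fun x => ∫ y, f y ∂η x := by
  refine integral_eq_of_approx _ hf (C := ‖ν‖) fun ε hε => ?_
  obtain ⟨g, hg⟩ := exists_simple_approx hf hε
  refine ⟨g, hg, ?_⟩
  have hgb : IsBddMeas g := by
    obtain ⟨C, hC⟩ := hf.2
    exact ⟨g.measurable, ε + C, fun x => by
      have := abs_add_le (g x - f x) (f x)
      rw [sub_add_cancel] at this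
      linarith [hg x, hC x]⟩
  have hb : ∀ y ∈ g.range, IsBddMeas fun x => y * (η x).real (g ⁻¹' {y}) := fun y _ =>
    (isBddMeas_kernel η (g.measurableSet_fiber y)).const_mul y
  have h1 : (markovOp η ν).simpleIntegral g = ν.integral fun x => ∫ y, g y ∂η x := by
    have h2 : (fun x => ∫ y, g y ∂η x) =
        fun x => ∑ y ∈ g.range, y * (η x).real (g ⁻¹' {y}) := by
      funext x
      rw [g.integral_eq_sum g.integrable_of_isFiniteMeasure]
      exact Finset.sum_congr rfl fun y _ => by rw [smul_eq_mul, mul_comm]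
    rw [h2, integral_sum ν _ hb]
    refine Finset.sum_congr rfl fun y _ => ?_
    rw [markovOp_apply η ν (g.measurableSet_fiber y),
      integral_const_mul ν y (isBddMeas_kernel η (g.measurableSet_fiber y))]
  have hFg := IsBddMeas.integral_kernel η hgb
  have hFf := (IsBddMeas.integral_kernel η hf).const_mul (-1)
  have h2 : ν.integral (fun x => ∫ y, g y ∂η x) - ν.integral (fun x => ∫ y, f y ∂η x) =
      ν.integral (fun x => ∫ y, g y ∂η x + -1 * ∫ y, f y ∂η x) := by
    rw [FinAddMeasure.integral_add ν hFg hFf,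
      FinAddMeasure.integral_const_mul ν (-1) (IsBddMeas.integral_kernel η hf)]
    ring
  rw [h1, h2]
  refine abs_integral_le ν (hFg.add hFf) fun x => ?_
  rw [neg_one_mul, ← sub_eq_add_neg, ← MeasureTheory.integral_sub
    (integrable_of_isBddMeas hgb _) (integrable_of_isBddMeas hf _)]
  have := norm_integral_le_of_norm_le_const (μ := η x) (f := fun y => g y - f y) (C := ε)
    (ae_of_all _ hg)
  simpa using this

theorem markovOp_pow (κ : Kernel X X) [IsMarkovKernel κ] {n : ℕ} (hn : 1 ≤ n)
    (ν : FinAddMeasure X) : (markovOp κ ^ n) ν = markovOp (κ ^ n) ν := by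
  induction n, hn using Nat.le_induction with
  | base => simp only [pow_one]
  | succ n _ ih =>
    refine ext_of_measurable fun E hE => ?_
    rw [pow_succ', mul_apply_eq_comp, ih, markovOp_apply κ _ hE,
      integral_markovOp _ _ (isBddMeas_kernel κ hE), markovOp_apply _ _ hE]
    congr 1
    funext x
    rw [kernel_pow_add_real κ n 1 x hE, pow_one]

theorem markovOpCA_pow_apply (κ : Kernel X X) [IsMarkovKernel κ] {n : ℕ} (hn : 1 ≤ n)
    (ν : caSubspace X) {E : Set X} (hE : MeasurableSet E) :
    (((markovOpCA κ ^ n) ν : caSubspace X) : FinAddMeasure X) E =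
      (ν : FinAddMeasure X).integral fun x => ((κ ^ n) x).real E := by
  have : ∀ n, (((markovOpCA κ ^ n) ν : caSubspace X) : FinAddMeasure X) =
      (markovOp κ ^ n) (ν : FinAddMeasure X) := by
    intro n
    induction n with
    | zero => rfl
    | succ n ih =>
      rw [pow_succ', pow_succ', mul_apply_eq_comp, mul_apply_eq_comp, ← ih]
      rfl
  rw [this, markovOp_pow κ hn, markovOp_apply _ _ hE]

/-- Evaluation at a set as a continuous linear functional. -/
def FinAddMeasure.evalCLM (E : Set X) : FinAddMeasure X →L[ℝ] ℝ :=
  LinearMap.mkContinuous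
    { toFun := fun μ => μ E
      map_add' := fun _ _ => rfl
      map_smul' := fun _ _ => rfl } 1 fun μ => by
    rw [one_mul]
    by_cases hE : MeasurableSet E
    · exact abs_apply_le_norm μ E hE
    · change |μ E| ≤ _
      rw [μ.not_measurable' E hE, abs_zero]
      exact norm_nonneg μ

/-- In a disjoint family the sets of nonnegative value contribute at most `C`, and so do the others.
-/
theorem FinAddMeasure.norm_le_two_mul {μ : FinAddMeasure X} {C : ℝ} (hC : 0 ≤ C)
    (h : ∀ E, MeasurableSet E → |μ E| ≤ C) : ‖μ‖ ≤ 2 * C := by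
  refine norm_le_of_sums μ fun n P hP hd => sum_abs_le_of_bound μ (C := C) (fun E => ?_)
    Finset.univ P (fun i _ => hP i) (fun i _ j _ h => hd h)
  by_cases hE : MeasurableSet E
  · exact h E hE
  · rw [μ.not_measurable' E hE, abs_zero]; exact hC

namespace IsDominatingInvariant

variable {κ : Kernel X X} [IsMarkovKernel κ] {φ : Measure X}

/-- The last `k` steps are averaged over the atoms with small error in `φ`-mean. By Markov's
inequality the error exceeds `1/8` only on a set of `φ`-measure at most `δ`, and the first `n` steps
reach that set with probability at most `1/8`, whatever `x` and `E` are. -/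
theorem exists_fiberAverage_approx (h : IsDominatingInvariant κ φ) :
    ∃ (n k : ℕ) (c : SimpleFunc X ℕ), 1 ≤ n ∧ ∀ E, MeasurableSet E → ∀ x,
      |((κ ^ (n + k)) x).real E - ∑ j ∈ c.range, ((κ ^ n) x).real (c ⁻¹' {j}) *
        fiberAverage φ c (fun y => ((κ ^ k) y).real E) j| ≤ 1 / 4 := by
  have := h.finite
  obtain ⟨n, δ, hn, hδ, hnδ⟩ := h.exists_pow_le (show (0 : ℝ) < 1 / 8 by norm_num)
  have hΦ : 0 ≤ φ.real Set.univ := measureReal_nonneg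
  -- The singular mass and twice the `L¹` error add up to at most `3δ/64`. Averaging doubles this,
  -- and Markov's inequality at level `1/8` gives `3δ/4 ≤ δ`.
  obtain ⟨k, δ', -, hδ', hk⟩ := h.exists_pow_le
    (show 0 < δ / (64 * (φ.real Set.univ + 1)) by positivity)
  obtain ⟨c, hc⟩ := exists_step_approx (φ := φ) (η := κ ^ k)
    (τ := δ / (64 * (φ.real Set.univ + 1))) (by positivity)
    (fun E hE h0 x => hk E hE (by rw [measureReal_def, h0]; exact hδ'.le) x)
    (show 0 < δ / 64 by positivity)
  refine ⟨n, k, c, hn, fun E hE x => ?_⟩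
  set f : X → ℝ := fun y => ((κ ^ k) y).real E with hf
  have hfb : IsBddMeas f := isBddMeas_kernel (κ ^ k) hE
  have hfi := integrable_of_isBddMeas hfb φ
  obtain ⟨u, hu, hcu, hfu⟩ := hc E hE
  have hτ : δ / (64 * (φ.real Set.univ + 1)) * φ.real Set.univ ≤ δ / 64 := by
    rw [div_mul_eq_mul_div, div_le_div_iff₀ (by positivity) (by norm_num)]
    nlinarith
  have hav := (integral_abs_sub_fiberAverage_le φ c hfi hu hcu).trans
    (mul_le_mul_of_nonneg_left hfu zero_le_two)
  set a : ℕ → ℝ := fiberAverage φ c f with ha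
  have hIcc : ∀ j, a j ∈ Set.Icc (0 : ℝ) 1 := fun j =>
    fiberAverage_mem_Icc φ c (fun y => measureReal_nonneg) (fun y => measureReal_le_one) hfi j
  have hab : IsBddMeas fun y => a (c y) := ⟨measurable_comp_simpleFunc c a, 1, fun y => by
    rw [abs_of_nonneg (hIcc _).1]; exact (hIcc _).2⟩
  have hd1 : ∀ y, |f y - a (c y)| ≤ 1 := fun y => by
    have h1 := hIcc (c y)
    have h2 : 0 ≤ f y := measureReal_nonneg
    have h3 : f y ≤ 1 := measureReal_le_one
    rw [abs_le]
    constructor <;> linarith [h1.1, h1.2]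
  have hdb : IsBddMeas fun y => |f y - a (c y)| :=
    ⟨(hfb.1.sub hab.1).abs, 1, fun y => by rw [abs_abs]; exact hd1 y⟩
  have hset : φ.real {y | 1 / 8 < |f y - a (c y)|} ≤ δ := by
    have h1 := mul_meas_ge_le_integral_of_nonneg (μ := φ)
      (ae_of_all _ fun y => abs_nonneg (f y - a (c y))) (integrable_of_isBddMeas hdb φ) (1 / 8)
    have h2 : φ.real {y | 1 / 8 < |f y - a (c y)|} ≤ φ.real {y | 1 / 8 ≤ |f y - a (c y)|} :=
      measureReal_mono fun y (hy : 1 / 8 < |f y - a (c y)|) => hy.le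
    linarith
  have hx := hnδ _ (measurableSet_lt measurable_const hdb.1) hset x
  have hbound := integral_le_add_measureReal_lt ((κ ^ n) x) hdb hd1
    (show (0 : ℝ) ≤ 1 / 8 by norm_num)
  have hsum : ∑ j ∈ c.range, ((κ ^ n) x).real (c ⁻¹' {j}) * a j =
      ∫ y, a (c y) ∂((κ ^ n) x) := by
    rw [integral_eq_sum_setIntegral_fiber c (integrable_of_isBddMeas hab _)]
    refine Finset.sum_congr rfl fun j _ => ?_
    rw [setIntegral_congr_fun (g := fun _ => a j) (c.measurableSet_fiber j)
      fun y (hy : c y = j) => by simp only [hy]]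
    rw [setIntegral_const, smul_eq_mul]
  rw [hsum, kernel_pow_add_real κ n k x hE, ← MeasureTheory.integral_sub
    (integrable_of_isBddMeas hfb _) (integrable_of_isBddMeas hab _)]
  refine abs_integral_le_integral_abs.trans ?_
  linarith

/-- The compact operator is `ν ↦ ∑ j, (Aⁿν)(B j) • w j` over the atoms `B j`, where `w j` is the
normalised restriction of `φ` to `B j` moved `k` steps. It has finite rank, and its kernel is the
sum approximating `p^(n+k)` within `1/4`. -/
theorem conditionK (h : IsDominatingInvariant κ φ) : ConditionK κ := by
  have := h.finite
  obtain ⟨n, k, c, hn, hc⟩ := h.exists_fiberAverage_approx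
  let w : ℕ → caSubspace X := fun j =>
    ⟨(φ.real (c ⁻¹' {j}))⁻¹ • ofMeasure ((φ.restrict (c ⁻¹' {j})).bind (κ ^ k)),
      Submodule.smul_mem _ _ (ofMeasure_mem_caSubspace _)⟩
  have hw : ∀ j E, MeasurableSet E → (w j : FinAddMeasure X) E =
      fiberAverage φ c (fun y => ((κ ^ k) y).real E) j := fun j E hE => by
    change (φ.real (c ⁻¹' {j}))⁻¹ * _ = _
    rw [ofMeasure_apply _ hE, ← integral_kernel_real _ _ hE]
    rfl
  let L : ℕ → caSubspace X →L[ℝ] ℝ := fun j =>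
    (evalCLM (c ⁻¹' {j})).comp ((caSubspace X).subtypeL.comp (markovOpCA κ ^ n))
  have hL : ∀ j ν, L j ν = (ν : FinAddMeasure X).integral
      fun x => ((κ ^ n) x).real (c ⁻¹' {j}) := fun j ν =>
    markovOpCA_pow_apply κ hn ν (c.measurableSet_fiber j)
  refine ⟨∑ j ∈ c.range, (L j).smulRight (w j), n + k, ?_, by omega, ?_⟩
  · change _ ∈ compactOperator (RingHom.id ℝ) (caSubspace X) (caSubspace X)
    refine Submodule.sum_mem _ fun j _ => ?_
    have hj : IsCompactOperator (ContinuousLinearMap.toSpanSingleton ℝ (w j)) :=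
      (isCompactOperator_id (E := ℝ)).clm_comp _
    exact hj.comp_clm (L j)
  · refine lt_of_le_of_lt (ContinuousLinearMap.opNorm_le_bound _ (M := 1 / 2) (by norm_num)
      fun ν => ?_) (by norm_num)
    rw [Submodule.coe_norm]
    -- The setwise error is at most `‖ν‖ / 4`, and passing to total variation doubles it, still
    -- leaving a norm below `1`.
    rw [show (1 / 2 : ℝ) * ‖ν‖ = 2 * (1 / 4 * ‖(ν : FinAddMeasure X)‖) by
      rw [Submodule.coe_norm]; ring]
    refine norm_le_two_mul (by positivity) fun E hE => ?_
    have hterm : ∀ j ∈ c.range, IsBddMeas fun x => ((κ ^ n) x).real (c ⁻¹' {j}) *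
        fiberAverage φ c (fun y => ((κ ^ k) y).real E) j := fun j _ => by
      simp only [mul_comm _ (fiberAverage _ _ _ _)]
      exact (isBddMeas_kernel (κ ^ n) (c.measurableSet_fiber j)).const_mul _
    have hA : ((∑ j ∈ c.range, (L j).smulRight (w j)) ν : FinAddMeasure X) E =
        (ν : FinAddMeasure X).integral fun x => ∑ j ∈ c.range, ((κ ^ n) x).real (c ⁻¹' {j}) *
          fiberAverage φ c (fun y => ((κ ^ k) y).real E) j := by
      rw [integral_sum _ _ hterm]
      simp only [_root_.sum_apply, ContinuousLinearMap.smulRight_apply,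
        Submodule.coe_sum, Submodule.coe_smul, FinAddMeasure.sum_apply,
        FinAddMeasure.smul_apply]
      refine Finset.sum_congr rfl fun j _ => ?_
      rw [hL, hw j E hE, mul_comm, ← FinAddMeasure.integral_const_mul _ _
        (isBddMeas_kernel (κ ^ n) (c.measurableSet_fiber j))]
      simp only [mul_comm]
    have hsumb := IsBddMeas.sum c.range hterm
    have hkb := isBddMeas_kernel (κ ^ (n + k)) hE
    have hdiff : ((((markovOpCA κ) ^ (n + k) - ∑ j ∈ c.range, (L j).smulRight (w j)) ν :
        caSubspace X) : FinAddMeasure X) E = (ν : FinAddMeasure X).integral fun x =>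
        ((κ ^ (n + k)) x).real E + -1 * ∑ j ∈ c.range, ((κ ^ n) x).real (c ⁻¹' {j}) *
          fiberAverage φ c (fun y => ((κ ^ k) y).real E) j := by
      rw [FinAddMeasure.integral_add _ hkb (hsumb.const_mul (-1)),
        FinAddMeasure.integral_const_mul _ _ hsumb, ← hA,
        ← markovOpCA_pow_apply κ (hn.trans (Nat.le_add_right n k)) ν hE,
        _root_.sub_apply, Submodule.coe_sub, FinAddMeasure.sub_apply]
      ring
    rw [hdiff]
    refine abs_integral_le _ (hkb.add (hsumb.const_mul (-1))) fun x => ?_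
    rw [neg_one_mul, ← sub_eq_add_neg]
    exact hc E hE x

end IsDominatingInvariant

end

/-! ### The theorem -/

theorem theorem5p5 {X : Type*} [MeasurableSpace X] (κ : ProbabilityTheory.Kernel X X)
    [ProbabilityTheory.IsMarkovKernel κ]
    (hfin : ConditionDoubleStar κ) (hα : ConditionAlpha κ) (hβ : ConditionBeta κ) :
    ConditionStar κ ∧ ConditionD κ ∧ ConditionDTilde κ ∧ ConditionK κ := by
  obtain ⟨φ, hφ⟩ := exists_isDominatingInvariant κ hfin hα hβ
  exact ⟨(exists_dominating_invariant κ hfin hα hβ).1, hφ.conditionD, hφ.conditionDTilde,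
    hφ.conditionK⟩
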